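/- Let $N\in\mathbb N$ and let $\Gamma$ be the star graph with edges $e_1,\dots,e_N$, each identified with $[0,\infty)$. Let $L^2=L^2(\Gamma)$ be the space of $\mathbf u=(u_{1,1},u_{1,2},\dots,u_{N,1},u_{N,2})$ with $u_{j,k}\in L^2(0,\infty)$ complex-valued, with $\|\mathbf u\|_2^2=\sum_{j,k}\|u_{j,k}\|_{L^2(0,\infty)}^2$, and let $[u]_j=(u_{j,1},u_{j,2})^t$. Let $\Delta$ be the second derivative on each edge, with domain $D(\Delta_\Gamma)$ the set of $\mathbf u\in L^2$ such that all $u_{j,k}\in H^2(0,\infty)$ and, for $k=1,2$, $u_{1,k}(0)=\dots=u_{N,k}(0)$ and $\sum_{j=1}^N u_{j,k}'(0)=0$. Let $F:[0,\infty)\to\mathbb R$ be smooth with $F(0)=0$, let $\alpha>0$, $w=\alpha^2/4$, and let $\varphi\in C^2(\mathbb R;\mathbb R)$ satisfy $\varphi''=\frac{\alpha^2}{4}\varphi+F(\varphi^2)\varphi$ on $\mathbb R$ and $\varphi(x)\to0$ as $|x|\to\infty$. Let $b_1,\dots,b_N\in\mathbb R$ and $\varphi_j(x)=\varphi(x-b_j)$.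 With $\theta_3=\begin{pmatrix}1&0\\0&-1\end{pmatrix}$ and $\theta_2=\begin{pmatrix}0&-i\\i&0\end{pmatrix}$, define on $D(\Delta_\Gamma)$ the operators $$[\mathcal H\mathbf u]_j=\Big(-\Delta+\frac{\alpha^2}{4}\Big)\theta_3[u]_j+\big[F(\varphi_j^2)+F'(\varphi_j^2)\varphi_j^2\big]\theta_3[u]_j+iF'(\varphi_j^2)\varphi_j^2\,\theta_2[u]_j,\qquad [J_0\mathbf u]_j=(-\Delta u_{j,1},\Delta u_{j,2})^t,$$ and let $e^{it\mathcal H}$ and $e^{itJ_0}$, $t\in\mathbb R$, be the strongly continuous one-parameter groups on $L^2$ generated by $i\mathcal H$ and $iJ_0$. Put $\rho(x)=(1+|x|)^{-1}$, and for $\varrho\in\mathbb R$ let $T_\varrho$ multiply every $u_{j,1}$ by $e^{i\varrho}$ and every $u_{j,2}$ by $e^{-i\varrho}$. Let $\mathbf f\in L^2$. If there is a constant $C$ with $\|\rho^2e^{-it\mathcal H}\mathbf f\|_2\le Ct^{-3/2}$ for all $t>0$, then there is $\mathbf f_+\in L^2$ such that $$\lim_{t\to\infty}\big\|e^{-it\mathcal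 H}\mathbf f-T_{-wt}\,e^{-itJ_0}\mathbf f_+\big\|_2=0.$$ Likewise, if there is a constant $C$ with $\|\rho^2e^{it\mathcal H}\mathbf f\|_2\le Ct^{-3/2}$ for all $t>0$, then there is $\mathbf f_+\in L^2$ such that $$\lim_{t\to\infty}\big\|e^{it\mathcal H}\mathbf f-T_{wt}\,e^{itJ_0}\mathbf f_+\big\|_2=0.$$ -/

import Mathlib

open Set Filter Topology MeasureTheory
open scoped ContDiff

noncomputable section

/-! ### One-parameter groups and the exponential of an unbounded operator -/

/-- `U` is the strongly continuous one-parameter group generated by `iA`, where the unbounded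
operator `A` is given by its graph: `A u v` means that `u` lies in the domain of `A` and `A u = v`.
The last field says that the generator of `U` is exactly `iA`, domains included. -/
structure IsGroupGeneratedBy {E : Type*} [NormedAddCommGroup E] [NormedSpace ℂ E]
    (A : E → E → Prop) (U : ℝ → E →L[ℂ] E) : Prop where
  zero : U 0 = ContinuousLinearMap.id ℂ E
  add : ∀ s t : ℝ, U (s + t) = (U s).comp (U t)
  cont : ∀ u : E, Continuous fun t : ℝ => U t u
  gen : ∀ u v : E, HasDerivAt (fun t : ℝ => U t u) (Complex.I • v) 0 ↔ A u v

open Classical in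
/-- `expI A t = e^{itA}`: the group generated by `iA` (it is unique, see
`IsGroupGeneratedBy.unique` below). -/
def expI {E : Type*} [NormedAddCommGroup E] [NormedSpace ℂ E]
    (A : E → E → Prop) (t : ℝ) : E →L[ℂ] E :=
  if h : ∃ U : ℝ → E →L[ℂ] E, IsGroupGeneratedBy A U then h.choose t else 0

/-! ### The space `L²(Γ)` of two-component functions on the star graph -/

/-- Lebesgue measure on an edge `(0, ∞)`. -/
abbrev edgeMeasure : Measure ℝ := volume.restrict (Ioi (0 : ℝ))

/-- The space `L²(0, ∞)` of complex-valued functions on an edge. -/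
abbrev EdgeL2 : Type := Lp ℂ 2 edgeMeasure

/-- The vector-`L²` space on the star graph with `N` edges: `u (j, 0)` and `u (j, 1)` are the two
components of `u` on the edge `j`, and `‖u‖² = ∑ j, ∑ k, ‖u (j, k)‖²`. -/
abbrev GraphL2 (N : ℕ) : Type := PiLp 2 fun _ : Fin N × Fin 2 => EdgeL2

/-- `u` is absolutely continuous on `[0, ∞)` with derivative `p` and boundary value `u(0) = a`.
As `u, p ∈ L²(0, ∞)`, this says that `u ∈ H¹(0, ∞)`, `u' = p` and `u(0) = a`. -/
def HasEdgeDeriv (u p : EdgeL2) (a : ℂ) : Prop :=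
  ∀ᵐ x ∂edgeMeasure, u x = a + ∫ y in (0 : ℝ)..x, p y

/-- `u ∈ D(Δ_Γ)` and `Δ_Γ u = d`: on every edge both components of `u` are in `H²(0, ∞)`
(`p = u'` and `d = u''`), their values at the vertex do not depend on the edge (`a k`), and the
derivatives at the vertex (`b j k`) sum to zero over the edges. -/
def IsGraphLaplacian {N : ℕ} (u d : GraphL2 N) : Prop :=
  ∃ (p : GraphL2 N) (a : Fin 2 → ℂ) (b : Fin N → Fin 2 → ℂ),
    (∀ j k, HasEdgeDeriv (u (j, k)) (p (j, k)) (a k)) ∧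
    (∀ j k, HasEdgeDeriv (p (j, k)) (d (j, k)) (b j k)) ∧
    ∀ k, ∑ j, b j k = 0

/-- The graph of `J₀`: `[J₀ u]_j = (-Δ u_{j,1}, Δ u_{j,2})` on `D(Δ_Γ)`. -/
def FreeOp (N : ℕ) (u v : GraphL2 N) : Prop :=
  ∃ d : GraphL2 N, IsGraphLaplacian u d ∧ ∀ j, v (j, 0) = -d (j, 0) ∧ v (j, 1) = d (j, 1)

/-- The phase rotation `T_ϱ`: multiplies first components by `e^{iϱ}`, second ones by `e^{-iϱ}`. -/
def phaseRot {N : ℕ} (r : ℝ) (u : GraphL2 N) : GraphL2 N :=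
  WithLp.toLp 2 fun i : Fin N × Fin 2 =>
    if i.2 = 0 then Complex.exp (Complex.I * r) • u i else Complex.exp (-(Complex.I * r)) • u i

/-- The weight `ρ(x) = (1 + |x|)⁻¹`. -/
def rho (x : ℝ) : ℝ := (1 + |x|)⁻¹

/-- The norm `‖ρ² u‖_{L²(Γ)}`. -/
def weightedNorm {N : ℕ} (u : GraphL2 N) : ℝ :=
  Real.sqrt (∑ i : Fin N × Fin 2, ∫ x, (rho x ^ 2 * ‖u i x‖) ^ 2 ∂edgeMeasure)

/-! ### Profile and linearized operator -/

/-- `φ` is a soliton profile: `φ'' = α² φ / 4 + F(φ²) φ` on the line and `φ(x) → 0` as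
`|x| → ∞`. -/
structure IsProfile (F : ℝ → ℝ) (α : ℝ) (φ : ℝ → ℝ) : Prop where
  contDiff : ContDiff ℝ 2 φ
  ode : ∀ x, deriv (deriv φ) x = α ^ 2 / 4 * φ x + F (φ x ^ 2) * φ x
  decay : Tendsto φ (cocompact ℝ) (𝓝 0)

/-- The off-diagonal coefficient `F'(φ²) φ²` of the potential. The nonlinearity `F` is a function
on `[0, ∞)`; its derivative at `0` is one-sided. -/
def offDiagCoeff (F φ : ℝ → ℝ) (y : ℝ) : ℝ :=
  derivWithin F (Ici 0) (φ y ^ 2) * φ y ^ 2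

/-- The diagonal coefficient `F(φ²) + F'(φ²) φ²` of the potential. -/
def diagCoeff (F φ : ℝ → ℝ) (y : ℝ) : ℝ :=
  F (φ y ^ 2) + offDiagCoeff F φ y

/-- The graph of the linearized operator `𝓗`, `D(𝓗) = D(Δ_Γ)`: on the edge `j`,
`H = (-Δ + α²/4) θ₃ + [F(φ_j²) + F'(φ_j²) φ_j²] θ₃ + i F'(φ_j²) φ_j² θ₂` with
`φ_j(x) = φ(x - b_j)`, `θ₃ = diag(1, -1)` and `i θ₂ = !![0, 1; -1, 0]`. -/
def LinearizedOp {N : ℕ} (F : ℝ → ℝ) (α : ℝ) (φ : ℝ → ℝ) (b : Fin N → ℝ)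
    (u v : GraphL2 N) : Prop :=
  ∃ d : GraphL2 N, IsGraphLaplacian u d ∧ ∀ j,
    (∀ᵐ x ∂edgeMeasure, v (j, 0) x =
      -d (j, 0) x + ((α ^ 2 / 4 : ℝ) : ℂ) * u (j, 0) x
        + (diagCoeff F φ (x - b j) : ℂ) * u (j, 0) x
        + (offDiagCoeff F φ (x - b j) : ℂ) * u (j, 1) x) ∧
    (∀ᵐ x ∂edgeMeasure, v (j, 1) x =
      -(-d (j, 1) x + ((α ^ 2 / 4 : ℝ) : ℂ) * u (j, 1) x)
        - (diagCoeff F φ (x - b j) : ℂ) * u (j, 1) x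
        - (offDiagCoeff F φ (x - b j) : ℂ) * u (j, 0) x)

end

/-! ### Uniqueness of the group -/

section Uniqueness

variable {E : Type*} [NormedAddCommGroup E] [NormedSpace ℂ E]
  {A : E → E → Prop} {U V : ℝ → E →L[ℂ] E}

theorem IsGroupGeneratedBy.hasDerivAt_zero_iff (hU : IsGroupGeneratedBy A U)
    (hV : IsGroupGeneratedBy A V) (x d : E) :
    HasDerivAt (fun t : ℝ => U t x) d 0 ↔ HasDerivAt (fun t : ℝ => V t x) d 0 := by
  have e : d = Complex.I • ((-Complex.I) • d) := by
    rw [smul_smul]; simp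
  rw [e, hU.gen, hV.gen]

/-- Orbits of vectors in the domain are differentiable at all times. -/
theorem IsGroupGeneratedBy.hasDerivAt (hU : IsGroupGeneratedBy A U) {x d : E}
    (h : HasDerivAt (fun t : ℝ => U t x) d 0) (s : ℝ) :
    HasDerivAt (fun t : ℝ => U t x) (U s d) s := by
  have h1 : HasDerivAt (fun t : ℝ => U (t - s) x) d s := by
    have h' : HasDerivAt (fun t : ℝ => U t x) d (s - s) := by simpa using h
    simpa using h'.comp_sub_const s s
  have h2 := ((U s).restrictScalars ℝ).hasFDerivAt.comp_hasDerivAt s h1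
  refine h2.congr_of_eventuallyEq (Eventually.of_forall fun t => ?_)
  have := hU.add s (t - s)
  rw [add_sub_cancel] at this
  simp [this]

theorem IsGroupGeneratedBy.tendsto_apply [CompleteSpace E] (hU : IsGroupGeneratedBy A U)
    {f : ℝ → ℝ} {y : ℝ → E} {y₀ : E} {s : ℝ} {l : Filter ℝ} (hf : Tendsto f l (𝓝 s))
    (hy : Tendsto y l (𝓝 y₀)) : Tendsto (fun h => U (f h) (y h)) l (𝓝 (U s y₀)) := by
  obtain ⟨C, hC⟩ : ∃ C, ∀ t : Icc (s - 1) (s + 1), ‖U t‖ ≤ C := by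
    refine banach_steinhaus fun x => ?_
    obtain ⟨C, hC⟩ := (isCompact_Icc (a := s - 1) (b := s + 1)).exists_bound_of_continuousOn
      (hU.cont x).continuousOn
    exact ⟨C, fun t => hC t t.2⟩
  have h1 : Tendsto (fun h => U (f h) y₀) l (𝓝 (U s y₀)) :=
    ((hU.cont y₀).tendsto s).comp hf
  have h2 : Tendsto (fun h => U (f h) (y h - y₀)) l (𝓝 0) := by
    have h3 : Tendsto (fun h => C * ‖y h - y₀‖) l (𝓝 0) := by
      have := (tendsto_iff_norm_sub_tendsto_zero.1 hy).const_mul C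
      simpa using this
    refine squeeze_zero_norm' ?_ h3
    filter_upwards [hf (Icc_mem_nhds (by linarith : s - 1 < s) (by linarith : s < s + 1))]
      with h hh
    exact (U (f h)).le_of_opNorm_le (hC ⟨f h, hh⟩) _
  have := h2.add h1
  simpa using this

/-- A strongly continuous group is determined by its generator. -/
theorem IsGroupGeneratedBy.unique [CompleteSpace E] (hU : IsGroupGeneratedBy A U)
    (hV : IsGroupGeneratedBy A V) : U = V := by
  -- on the domain
  have key : ∀ x d : E, HasDerivAt (fun t : ℝ => V t x) d 0 → ∀ t, U t x = V t x := by
    intro x d hx t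
    have hW : ∀ s : ℝ, HasDerivAt (fun r : ℝ => U (t - r) (V r x)) 0 s := by
      intro s
      have hs := hV.hasDerivAt hx s
      have h0 : HasDerivAt (fun r : ℝ => V r (V s x)) (V s d) 0 := by
        have : HasDerivAt (fun r : ℝ => V (r + s) x) (V s d) 0 := by
          have h' : HasDerivAt (fun r : ℝ => V r x) (V s d) (0 + s) := by simpa using hs
          simpa using h'.comp_add_const 0 s
        refine this.congr_of_eventuallyEq (Eventually.of_forall fun r => ?_)
        simp [hV.add r s]
      have h1 := hU.hasDerivAt ((hU.hasDerivAt_zero_iff hV _ _).2 h0) (t - s)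
      have h2 : HasDerivAt (fun r : ℝ => U (t - r) (V s x)) (-(U (t - s) (V s d))) s := by
        have := h1.scomp s ((hasDerivAt_id s).const_sub t)
        simpa [Function.comp_def] using this
      rw [hasDerivAt_iff_tendsto_slope] at hs h2 ⊢
      have hf : Tendsto (fun r : ℝ => t - r) (𝓝[≠] s) (𝓝 (t - s)) :=
        ((continuous_const.sub continuous_id).tendsto s).mono_left nhdsWithin_le_nhds
      have h3 := (hU.tendsto_apply hf hs).add h2
      rw [add_neg_cancel] at h3
      refine h3.congr fun r => ?_
      simp only [slope_def_module]
      rw [← Complex.coe_smul, ← Complex.coe_smul, ← Complex.coe_smul]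
      simp only [map_smul, map_sub]
      rw [← smul_add]
      congr 1
      abel
    have hc := is_const_of_deriv_eq_zero (fun s => (hW s).differentiableAt)
      (fun s => (hW s).deriv) 0 t
    simpa [hU.zero, hV.zero] using hc
  -- the domain is dense
  funext t
  ext x
  let F : ℝ → E := fun r => ∫ s in (0 : ℝ)..r, V s x
  have hF : ∀ r, HasDerivAt F (V r x) r := fun r =>
    intervalIntegral.integral_hasDerivAt_right ((hV.cont x).intervalIntegrable _ _)
      ((hV.cont x).stronglyMeasurableAtFilter _ _) (hV.cont x).continuousAt
  have hdom : ∀ r, U t (F r) = V t (F r) := by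
    intro r
    refine key (F r) (V r x - x) ?_ t
    have e : ∀ q : ℝ, V q (F r) = F (q + r) - F q := by
      intro q
      have h1 : V q (F r) = ∫ s in (0 : ℝ)..r, V (q + s) x := by
        change (V q) (∫ s in (0 : ℝ)..r, V s x) = _
        rw [← ContinuousLinearMap.intervalIntegral_comp_comm _
          ((hV.cont x).intervalIntegrable _ _)]
        simp [hV.add]
      rw [h1, intervalIntegral.integral_comp_add_left (fun s => V s x) q, add_zero]
      exact (intervalIntegral.integral_interval_sub_left
        ((hV.cont x).intervalIntegrable _ _) ((hV.cont x).intervalIntegrable _ _)).symm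
    have h1 : HasDerivAt (fun q : ℝ => F (q + r)) (V r x) 0 := by
      have h' : HasDerivAt F (V r x) (0 + r) := by simpa using hF r
      simpa using h'.comp_add_const 0 r
    have h2 : HasDerivAt F x 0 := by simpa [hV.zero] using hF 0
    exact (h1.sub h2).congr_of_eventuallyEq (Eventually.of_forall e)
  have hx : HasDerivAt F x 0 := by simpa [hV.zero] using hF 0
  have hUx := ((U t).restrictScalars ℝ).hasFDerivAt.comp_hasDerivAt (0 : ℝ) hx
  have hVx := ((V t).restrictScalars ℝ).hasFDerivAt.comp_hasDerivAt (0 : ℝ) hx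
  refine hUx.unique (hVx.congr_of_eventuallyEq (Eventually.of_forall fun r => ?_))
  simpa using hdom r

theorem expI_eq [CompleteSpace E] (hU : IsGroupGeneratedBy A U) : expI A = U := by
  funext t
  have h : ∃ U : ℝ → E →L[ℂ] E, IsGroupGeneratedBy A U := ⟨U, hU⟩
  rw [expI, dif_pos h, h.choose_spec.unique hU]

end Uniqueness

/-! This is Cook's method. With $w=\alpha^2/4$ one has $\mathcal H=J_0+w\theta_3+V$, where $V$ is
multiplication by a matrix of size $O(\rho^2)$, and $U_1(t)=T_{wt}e^{itJ_0}$ is the unitary group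
generated by $i(J_0+w\theta_3)$. In the interaction picture, $Y(t)=U_1(-t)e^{it\mathcal H}f$ has
derivative $U_1(-t)\,iVe^{it\mathcal H}f$, of norm at most a constant times $\|\rho^2e^{it\mathcal
H}f\|_2$. The assumed rate $t^{-3/2}$ is integrable at infinity, so $Y(t)$ has a limit $f_+$; since
$U_1(t)$ is isometric, the norm in the claim equals $\|Y(t)-f_+\|_2$. The other time direction uses
$Y(-t)$.

The bound on $V$ comes from the profile equation: far out, where $F(\varphi^2)$ is small,
$(\varphi^2)''\ge\kappa^2\varphi^2$ with $\kappa=\alpha/2$, so $\varphi^2$ decays exponentially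
(`exp_decay_of_deriv2_ge`), and the coefficients are $O(\varphi^2)$ because $F(0)=0$.

Most of the work is to show that the groups exist, since `expI` is zero otherwise. The Laplacian
with Kirchhoff conditions is $-\Delta_\Gamma=T^*T$, where $T$ is the derivative on $H^1$ functions
continuous at the vertex (`isGraphLaplacian_iff`). Von Neumann's theorem gives self-adjoint
contractive resolvents (`exists_resolvent_adjointMulSelf`); they commute with $\theta_3$, and the
Yosida approximations of $J_0=\theta_3T^*T$ exponentiate to a unitary group
(`exists_group_of_resolvent`). The potential $V$ is bounded but need not be self-adjoint, so
$e^{it\mathcal H}$ is built from a Dyson series (`IsGroupGeneratedBy.exists_perturbation`), which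
also makes $Y$ differentiable for every $f$, in the domain or not. -/

/-! ### Unitary groups of bounded self-adjoint operators and their strong limits -/

section BoundedUnitary

variable {E : Type*} [NormedAddCommGroup E] [InnerProductSpace ℂ E] [CompleteSpace E]

/-- The unitary group `e^{ita}` of a bounded operator `a`. -/
noncomputable def boundedGroup (a : E →L[ℂ] E) (t : ℝ) : E →L[ℂ] E :=
  NormedSpace.exp (t • (Complex.I • a))

theorem boundedGroup_zero (a : E →L[ℂ] E) : boundedGroup a 0 = 1 := by
  simp [boundedGroup]

theorem boundedGroup_add (a : E →L[ℂ] E) (s t : ℝ) :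
    boundedGroup a (s + t) = boundedGroup a s * boundedGroup a t := by
  let _ : NormedAlgebra ℚ (E →L[ℂ] E) := NormedAlgebra.restrictScalars ℚ ℂ _
  rw [boundedGroup, add_smul]
  exact NormedSpace.exp_add_of_commute (((Commute.refl _).smul_left s).smul_right t)

theorem norm_boundedGroup_apply {a : E →L[ℂ] E} (ha : IsSelfAdjoint a) (t : ℝ) (x : E) :
    ‖boundedGroup a t x‖ = ‖x‖ := by
  have h1 : ContinuousLinearMap.adjoint (boundedGroup a t) = boundedGroup a (-t) := by
    rw [← ContinuousLinearMap.star_eq_adjoint, boundedGroup, NormedSpace.star_exp, boundedGroup,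
      ← Complex.coe_smul, ← Complex.coe_smul, star_smul, star_smul, ha.star_eq]
    congr 1
    simp [smul_smul]
  have h2 : ContinuousLinearMap.adjoint (boundedGroup a t) (boundedGroup a t x) = x := by
    have := congrArg (fun w : E →L[ℂ] E => w x) (boundedGroup_add a (-t) t)
    simpa [h1, boundedGroup_zero] using this.symm
  rw [@norm_eq_sqrt_re_inner ℂ, @norm_eq_sqrt_re_inner ℂ, ← ContinuousLinearMap.adjoint_inner_left,
    h2]

theorem hasDerivAt_boundedGroup_apply (a : E →L[ℂ] E) (x : E) (t : ℝ) :
    HasDerivAt (fun s => boundedGroup a s x) (boundedGroup a t (Complex.I • a x)) t := by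
  have h := hasDerivAt_exp_smul_const (𝕂 := ℝ) (Complex.I • a) t
  exact ((ContinuousLinearMap.apply ℂ E x).restrictScalars ℝ).hasFDerivAt.comp_hasDerivAt t h

theorem norm_boundedGroup_sub_self_le {a : E →L[ℂ] E} (ha : IsSelfAdjoint a) (t : ℝ) (x : E) :
    ‖boundedGroup a t x - x‖ ≤ |t| * ‖a x‖ := by
  have h := convex_univ.norm_image_sub_le_of_norm_hasDerivWithin_le (𝕜 := ℝ) (C := ‖a x‖)
    (fun s _ => (hasDerivAt_boundedGroup_apply a x s).hasDerivWithinAt)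
    (fun s _ => by rw [norm_boundedGroup_apply ha, norm_smul]; simp) (mem_univ 0) (mem_univ t)
  simpa [boundedGroup_zero, mul_comm] using h

/-- By commutativity $e^{ita}=e^{itb}e^{it(a-b)}$, and $e^{itb}$ is isometric, so only the
displacement of $x$ under $e^{it(a-b)}$ matters. The bound sees $a$ and $b$ only through $ax-bx$,
which is what survives when operator norms blow up. -/
theorem norm_boundedGroup_sub_le {a b : E →L[ℂ] E} (ha : IsSelfAdjoint a) (hb : IsSelfAdjoint b)
    (hab : Commute a b) (t : ℝ) (x : E) :
    ‖boundedGroup a t x - boundedGroup b t x‖ ≤ |t| * ‖a x - b x‖ := by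
  have h : boundedGroup a t = boundedGroup b t * boundedGroup (a - b) t := by
    let _ : NormedAlgebra ℚ (E →L[ℂ] E) := NormedAlgebra.restrictScalars ℚ ℂ _
    have hc : Commute (t • Complex.I • b) (t • Complex.I • (a - b)) :=
      ((((hab.symm.sub_right (Commute.refl b)).smul_left _).smul_right _).smul_left _).smul_right _
    rw [boundedGroup, boundedGroup, boundedGroup, ← NormedSpace.exp_add_of_commute hc,
      ← smul_add, ← smul_add, add_sub_cancel]
  calc ‖boundedGroup a t x - boundedGroup b t x‖
      = ‖boundedGroup b t (boundedGroup (a - b) t x - x)‖ := by rw [h, map_sub]; rfl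
    _ ≤ |t| * ‖a x - b x‖ := by
      rw [norm_boundedGroup_apply hb]
      exact norm_boundedGroup_sub_self_le (ha.sub hb) t x

variable {a : ℕ → E →L[ℂ] E} {D : Set E}

/-- For $y\in D$ the previous estimate is uniform in $|t|\le T$; isometry transfers it to $x$ at a
cost of $2\|x-y\|$. -/
theorem uniformCauchySeqOn_boundedGroup (ha : ∀ n, IsSelfAdjoint (a n))
    (hcomm : ∀ n m, Commute (a n) (a m)) (hD : Dense D)
    (hcv : ∀ x ∈ D, CauchySeq fun n => a n x) (x : E) (T : ℝ) :
    UniformCauchySeqOn (fun n t => boundedGroup (a n) t x) atTop (Icc (-T) T) := by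
  rw [Metric.uniformCauchySeqOn_iff]
  intro ε hε
  obtain ⟨y, hy, hxy⟩ := Metric.dense_iff.1 hD x (ε / 4) (by positivity)
  rw [Metric.mem_ball, dist_eq_norm] at hy
  obtain ⟨k, hk⟩ := Metric.cauchySeq_iff.1 (hcv y hxy) (ε / (2 * (|T| + 1))) (by positivity)
  refine ⟨k, fun m hm n hn t ht => ?_⟩
  have h1 := hk m hm n hn
  rw [dist_eq_norm] at h1 ⊢
  have h2 := norm_boundedGroup_sub_le (ha m) (ha n) (hcomm m n) t y
  have e : boundedGroup (a m) t x - boundedGroup (a n) t x = boundedGroup (a m) t (x - y)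
      + (boundedGroup (a m) t y - boundedGroup (a n) t y) - boundedGroup (a n) t (x - y) := by
    simp only [map_sub]; abel
  have h3 : |t| ≤ |T| + 1 := by
    have := abs_le.2 ⟨ht.1, ht.2⟩
    linarith [le_abs_self T]
  have h4 : |t| * ‖a m y - a n y‖ ≤ (|T| + 1) * (ε / (2 * (|T| + 1))) := by gcongr
  have h5 : (|T| + 1) * (ε / (2 * (|T| + 1))) = ε / 2 := by field_simp
  rw [e]
  refine (norm_sub_le _ _).trans_lt ?_
  refine (add_le_add_left (norm_add_le _ _) _).trans_lt ?_
  rw [norm_boundedGroup_apply (ha m), norm_boundedGroup_apply (ha n), norm_sub_rev x y]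
  linarith

/-- If commuting bounded self-adjoint operators `a n` converge on a dense set, then the groups
`e^{it a n}` converge strongly to a unitary group whose generator extends `i lim a n`. -/
theorem exists_group_of_tendsto (ha : ∀ n, IsSelfAdjoint (a n))
    (hcomm : ∀ n m, Commute (a n) (a m)) (hD : Dense D)
    (hcv : ∀ x ∈ D, CauchySeq fun n => a n x) :
    ∃ U : ℝ → E →L[ℂ] E, U 0 = ContinuousLinearMap.id ℂ E ∧
      (∀ s t, U (s + t) = (U s).comp (U t)) ∧ (∀ x, Continuous fun t => U t x) ∧
      (∀ t x, ‖U t x‖ = ‖x‖) ∧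
      ∀ x v, Tendsto (fun n => a n x) atTop (𝓝 v) →
        HasDerivAt (fun t => U t x) (Complex.I • v) 0 := by
  have hU := fun x T => uniformCauchySeqOn_boundedGroup ha hcomm hD hcv x T
  have hlim : ∀ t x, ∃ y, Tendsto (fun n => boundedGroup (a n) t x) atTop (𝓝 y) := fun t x =>
    cauchySeq_tendsto_of_complete ((hU x |t|).cauchySeq ⟨neg_abs_le t, le_abs_self t⟩)
  choose f hf using hlim
  let U : ℝ → E →L[ℂ] E := fun t =>
    continuousLinearMapOfTendsto (fun n => boundedGroup (a n) t) (tendsto_pi_nhds.2 (hf t))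
  have hUt : ∀ t x, Tendsto (fun n => boundedGroup (a n) t x) atTop (𝓝 (U t x)) := hf
  have hnorm : ∀ t x, ‖U t x‖ = ‖x‖ := fun t x =>
    tendsto_nhds_unique (hUt t x).norm (by simp [norm_boundedGroup_apply (ha _)])
  have hunif : ∀ x T, TendstoUniformlyOn (fun n t => boundedGroup (a n) t x) (fun t => U t x)
      atTop (Icc (-T) T) := fun x T => (hU x T).tendstoUniformlyOn_of_tendsto fun t _ => hUt t x
  refine ⟨U, ?_, ?_, ?_, hnorm, ?_⟩
  · ext x
    exact tendsto_nhds_unique (hUt 0 x) (by simp [boundedGroup_zero])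
  · intro s t
    ext x
    refine tendsto_nhds_unique (hUt (s + t) x) ?_
    have h : Tendsto (fun n => boundedGroup (a n) s (boundedGroup (a n) t x - U t x)
        + boundedGroup (a n) s (U t x)) atTop (𝓝 (0 + U s (U t x))) := by
      refine Tendsto.add ?_ (hUt s _)
      refine squeeze_zero_norm (fun n => (norm_boundedGroup_apply (ha n) s _).le) ?_
      exact tendsto_iff_norm_sub_tendsto_zero.1 (hUt t x)
    simpa [boundedGroup_add] using h
  · intro x
    refine continuous_iff_continuousAt.2 fun t => ?_
    have h : ContinuousOn (fun t => U t x) (Icc (-(|t| + 1)) (|t| + 1)) :=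
      (hunif x _).continuousOn (Frequently.of_forall fun n s _ =>
        (hasDerivAt_boundedGroup_apply (a n) x s).continuousAt.continuousWithinAt)
    exact h.continuousAt (Icc_mem_nhds (by linarith [neg_abs_le t]) (by linarith [le_abs_self t]))
  · intro x v hv
    -- The derivatives of the approximating orbits converge uniformly near $0$, so the limiting
    -- orbit may be differentiated termwise.
    have h : TendstoUniformlyOn (fun n t => boundedGroup (a n) t (Complex.I • a n x))
        (fun t => U t (Complex.I • v)) atTop (Ioo (-1) 1) := by
      rw [Metric.tendstoUniformlyOn_iff]
      intro ε hε
      have h1 := Metric.tendstoUniformlyOn_iff.1 (hunif (Complex.I • v) 1) (ε / 2) (by positivity)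
      have h2 := Metric.tendsto_nhds.1 hv (ε / 2) (by positivity)
      filter_upwards [h1, h2] with n hn1 hn2 t ht
      refine (dist_triangle _ _ _).trans_lt
        ((add_lt_add (hn1 t (Ioo_subset_Icc_self ht)) ?_).trans_eq (add_halves ε))
      rw [dist_eq_norm, ← map_sub, norm_boundedGroup_apply (ha n), ← smul_sub, norm_smul]
      rw [dist_eq_norm, norm_sub_rev] at hn2
      simpa using hn2
    have := hasDerivAt_of_tendstoUniformlyOn isOpen_Ioo h
      (Eventually.of_forall fun n t _ => hasDerivAt_boundedGroup_apply (a n) x t)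
      (fun t _ => hUt t x) (show (0 : ℝ) ∈ Ioo (-1 : ℝ) 1 by norm_num)
    have h0 : U 0 (Complex.I • v) = Complex.I • v :=
      tendsto_nhds_unique (hUt 0 _) (by simp [boundedGroup_zero])
    rwa [h0] at this

end BoundedUnitary

/-! ### Yosida approximation: from resolvents to a unitary group -/

section Yosida

variable {E : Type*} [NormedAddCommGroup E] [InnerProductSpace ℂ E]
  {L : E → E → Prop} {S : ℕ → E →L[ℂ] E} {J : E →L[ℂ] E}

/-- The hypothesis `hS` says $S_n=(1+L/(n+1))^{-1}$, without assuming that the relation $L$ is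
linear. This is the first resolvent identity for $S_n=(n+1)(n+1+L)^{-1}$ with denominators cleared.
-/
theorem resolvent_identity (hS : ∀ n u v, L u v ↔ S n (u + (1 / (n + 1 : ℂ)) • v) = u) (n m : ℕ) :
    ((n : ℂ) - m) • (S n * S m) = (n + 1 : ℂ) • S m - (m + 1 : ℂ) • S n := by
  have hn : (n + 1 : ℂ) ≠ 0 := n.cast_add_one_ne_zero
  have hm : (m + 1 : ℂ) ≠ 0 := m.cast_add_one_ne_zero
  ext f
  have h1 : L (S m f) ((m + 1 : ℂ) • (f - S m f)) := by
    rw [hS m, smul_smul, one_div_mul_cancel hm, one_smul, add_sub_cancel]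
  rw [hS n, smul_smul, smul_sub, map_add, map_sub, map_smul, map_smul] at h1
  have h2 : (n + 1 : ℂ) • S m f = (n + 1 : ℂ) • S n (S m f)
      + ((m + 1 : ℂ) • S n f - (m + 1 : ℂ) • S n (S m f)) := by
    nth_rewrite 1 [← h1]
    rw [smul_add, smul_sub, smul_smul, smul_smul]
    congr 3 <;> field_simp
  simp only [smul_apply, sub_apply,
    mul_apply_eq_comp]
  rw [h2]
  module

theorem resolvent_commute (hS : ∀ n u v, L u v ↔ S n (u + (1 / (n + 1 : ℂ)) • v) = u)
    (n m : ℕ) : Commute (S n) (S m) := by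
  rcases eq_or_ne n m with rfl | h
  · exact Commute.refl _
  · have h' : (n : ℂ) - m ≠ 0 := sub_ne_zero.2 (by exact_mod_cast h)
    have h1 := resolvent_identity hS n m
    have h2 := resolvent_identity hS m n
    refine smul_right_injective (E →L[ℂ] E) h' ?_
    change ((n : ℂ) - m) • (S n * S m) = ((n : ℂ) - m) • (S m * S n)
    rw [h1, ← neg_sub (m : ℂ) n, neg_smul, h2, neg_sub]

/-- On the domain, $y-S_ny=S_nLy/(n+1)\to0$; contractivity extends this to the closure. -/
theorem tendsto_resolvent (hS : ∀ n u v, L u v ↔ S n (u + (1 / (n + 1 : ℂ)) • v) = u)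
    (hS1 : ∀ n x, ‖S n x‖ ≤ ‖x‖) (hD : Dense {u | ∃ v, L u v}) (x : E) :
    Tendsto (fun n => S n x) atTop (𝓝 x) := by
  rw [Metric.tendsto_atTop]
  intro ε hε
  obtain ⟨y, hy, v, hv⟩ := Metric.dense_iff.1 hD x (ε / 3) (by positivity)
  rw [Metric.mem_ball, dist_comm, dist_eq_norm] at hy
  have h1 : Tendsto (fun n : ℕ => 1 / ((n : ℝ) + 1) * ‖v‖) atTop (𝓝 0) := by
    simpa using tendsto_one_div_add_atTop_nhds_zero_nat.mul_const ‖v‖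
  obtain ⟨k, hk⟩ := (h1.eventually (gt_mem_nhds (show 0 < ε / 3 by positivity))).exists_forall_of_atTop
  refine ⟨k, fun n hn => ?_⟩
  have h2 := (hS n y v).1 hv
  rw [map_add, map_smul] at h2
  have h3 : ‖S n y - y‖ ≤ 1 / ((n : ℝ) + 1) * ‖v‖ := by
    have e : S n y - y = -((1 / (n + 1 : ℂ)) • S n v) := by
      nth_rewrite 2 [← h2]; abel
    rw [e, norm_neg, norm_smul]
    have : ‖(1 / (n + 1 : ℂ))‖ = 1 / ((n : ℝ) + 1) := by
      rw [norm_div, norm_one]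
      congr 1
      exact_mod_cast Complex.norm_natCast (n + 1)
    rw [this]
    gcongr
    exact hS1 n v
  have e : S n x - x = S n (x - y) + (S n y - y) - (x - y) := by rw [map_sub]; abel
  rw [dist_eq_norm, e]
  have h4 := hS1 n (x - y)
  have h5 := hk n hn
  refine (norm_sub_le _ _).trans_lt ?_
  have h6 := norm_add_le (S n (x - y)) (S n y - y)
  linarith

variable [CompleteSpace E]

/-- The domain contains the range of $S_0$. A vector orthogonal to that range lies in the kernel of
the self-adjoint $S_0$, hence is a value of $L$ at $0$, hence vanishes by `h0`. -/
theorem dense_domain_of_resolvent (hS : ∀ n u v, L u v ↔ S n (u + (1 / (n + 1 : ℂ)) • v) = u)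
    (hsa : ∀ n, IsSelfAdjoint (S n)) (h0 : ∀ v, L 0 v → v = 0) :
    Dense {u | ∃ v, L u v} := by
  have h1 : Dense ((LinearMap.range (S 0 : E →ₗ[ℂ] E) : Submodule ℂ E) : Set E) := by
    rw [Submodule.dense_iff_topologicalClosure_eq_top, Submodule.topologicalClosure_eq_top_iff,
      Submodule.eq_bot_iff]
    intro x hx
    refine h0 x ((hS 0 0 x).2 ?_)
    have h2 : S 0 x = 0 := by
      refine ext_inner_left ℂ fun z => ?_
      rw [inner_zero_right]
      exact ((ContinuousLinearMap.isSelfAdjoint_iff_isSymmetric.1 (hsa 0)) z x).symm.trans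
        (hx _ ⟨z, rfl⟩)
    simpa using h2
  refine h1.mono ?_
  rintro _ ⟨z, rfl⟩
  refine ⟨z - S 0 z, (hS 0 _ _).2 ?_⟩
  simp

/-- The unitary group generated by `i J L`, where `L` is given by its (compatible) resolvents
`S n = (1 + L / (n + 1))⁻¹` and the symmetry `J` commutes with them. -/
theorem exists_group_of_resolvent (hS : ∀ n u v, L u v ↔ S n (u + (1 / (n + 1 : ℂ)) • v) = u)
    (hsa : ∀ n, IsSelfAdjoint (S n)) (hS1 : ∀ n x, ‖S n x‖ ≤ ‖x‖) (h0 : ∀ v, L 0 v → v = 0)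
    (hJ : IsSelfAdjoint J) (hJJ : ∀ x, J (J x) = x) (hJS : ∀ n, Commute J (S n)) :
    ∃ U : ℝ → E →L[ℂ] E, IsGroupGeneratedBy (fun u v => L u (J v)) U ∧ ∀ t x, ‖U t x‖ = ‖x‖ := by
  have hD := dense_domain_of_resolvent hS hsa h0
  -- The Yosida approximation $JLS_n$, written as $(n+1)J(1-S_n)$ so that it is visibly bounded.
  let a : ℕ → E →L[ℂ] E := fun n => ((n + 1 : ℝ) : ℂ) • (J * (1 - S n))
  have ha : ∀ n, IsSelfAdjoint (a n) := fun n =>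
    IsSelfAdjoint.smul (Complex.conj_ofReal _)
      ((hJ.commute_iff ((IsSelfAdjoint.one _).sub (hsa n))).1
        ((Commute.one_right J).sub_right (hJS n)))
  have hcomm : ∀ n m, Commute (a n) (a m) := fun n m => by
    refine Commute.smul_left (Commute.smul_right ?_ _) _
    have h1 : Commute J (1 - S m) := (Commute.one_right J).sub_right (hJS m)
    have h2 : Commute J (1 - S n) := (Commute.one_right J).sub_right (hJS n)
    have h3 : Commute (1 - S n) (1 - S m) := Commute.sub_left (Commute.one_left _)
      (Commute.sub_right (Commute.one_right _) (resolvent_commute hS n m))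
    exact ((Commute.refl J).mul_right h1).mul_left (h2.symm.mul_right h3)
  have hlim : ∀ u v, L u (J v) → Tendsto (fun n => a n u) atTop (𝓝 v) := by
    intro u v huv
    refine (tendsto_resolvent hS hS1 hD v).congr fun n => ?_
    have h1 := (hS n u _).1 huv
    rw [map_add, map_smul] at h1
    have h2 : u - S n u = (1 / (n + 1 : ℂ)) • S n (J v) := by
      nth_rewrite 1 [← h1]; abel
    have h3 : S n (J v) = J (S n v) := congrArg (fun w : E →L[ℂ] E => w v) (hJS n).eq.symm
    have hn : (n + 1 : ℂ) ≠ 0 := n.cast_add_one_ne_zero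
    simp only [a, smul_apply, mul_apply_eq_comp,
      sub_apply, one_apply_eq_self]
    rw [h2, h3, map_smul, hJJ, smul_smul]
    push_cast
    rw [mul_one_div_cancel hn, one_smul]
  obtain ⟨U, hU0, hUadd, hUcont, hUnorm, hUgen⟩ := exists_group_of_tendsto ha hcomm hD
    (by
      rintro u ⟨v, hv⟩
      exact (hlim u (J v) (by rwa [hJJ])).cauchySeq)
  refine ⟨U, ⟨hU0, hUadd, hUcont, fun u v => ⟨fun h => ?_, fun h => hUgen u v (hlim u v h)⟩⟩, hUnorm⟩
  have hsymm : ∀ n x y, inner ℂ (S n x) y = inner ℂ x (S n y) := fun n =>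
    ContinuousLinearMap.isSelfAdjoint_iff_isSymmetric.1 (hsa n)
  have hJsymm : ∀ x y, inner ℂ (J x) y = inner ℂ x (J y) :=
    ContinuousLinearMap.isSelfAdjoint_iff_isSymmetric.1 hJ
  have hJS' : ∀ x, S 0 (J x) = J (S 0 x) := fun x =>
    congrArg (fun w : E →L[ℂ] E => w x) (hJS 0).eq.symm
  -- The generator is no larger than $iJL$: by unitarity the pairing of the orbits of $u$ and of
  -- $S_0z$ is constant, and its derivative at $0$ gives $\langle v,S_0z\rangle=\langle
  -- u,J(z-S_0z)\rangle$ for every $z$. Moving the symmetric operators across puts $u$ in the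
  -- domain.
  have key : S 0 v = J u - S 0 (J u) := by
    refine ext_inner_right ℂ fun z => ?_
    have hy : HasDerivAt (fun t => U t (S 0 z)) (Complex.I • J (z - S 0 z)) 0 := by
      refine hUgen _ _ (hlim _ _ ?_)
      rw [hJJ, hS 0]
      simp
    have hiso : ∀ t x y, inner ℂ (U t x) (U t y) = inner ℂ x y := fun t x y =>
      (LinearIsometry.inner_map_map (⟨(U t : E →ₗ[ℂ] E), hUnorm t⟩ : E →ₗᵢ[ℂ] E) x y)
    have h1 := h.inner ℂ hy
    simp only [hiso, hU0, ContinuousLinearMap.id_apply] at h1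
    have h2 := h1.unique (hasDerivAt_const (0 : ℝ) (inner ℂ u (S 0 z)))
    rw [inner_smul_left, inner_smul_right, Complex.conj_I, neg_mul, ← sub_eq_add_neg,
      ← mul_sub] at h2
    have h3 := sub_eq_zero.1 ((mul_eq_zero.1 h2).resolve_left Complex.I_ne_zero)
    rw [hsymm, ← h3, ← hJsymm, inner_sub_right, inner_sub_left, hsymm]
  rw [hS 0]
  have h4 : S 0 (J v) = u - S 0 u := by
    rw [hJS', key, map_sub, hJJ, hJS', hJJ]
  simp [h4]

end Yosida

/-! ### Dyson series for strongly continuous bounded families -/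

section Dyson

variable {E : Type*} [NormedAddCommGroup E] [NormedSpace ℂ E]
  {G : ℝ → E →L[ℂ] E} {M : ℝ}

theorem continuous_apply_of_bound (hG : ∀ t x, ‖G t x‖ ≤ M * ‖x‖)
    (hc : ∀ x, Continuous fun t => G t x) {y : ℝ → E} (hy : Continuous y) :
    Continuous fun t => G t (y t) := by
  refine continuous_iff_continuousAt.2 fun s => ?_
  have h1 : Tendsto (fun t => G t (y t - y s)) (𝓝 s) (𝓝 0) := by
    refine squeeze_zero_norm (fun t => hG t _) ?_
    simpa using (tendsto_iff_norm_sub_tendsto_zero.1 (hy.tendsto s)).const_mul M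
  simpa [ContinuousAt] using h1.add ((hc (y s)).tendsto s)

/-- The terms of the Dyson series. -/
noncomputable def dysonTerm (G : ℝ → E →L[ℂ] E) (f : E) : ℕ → ℝ → E
  | 0, _ => f
  | k + 1, t => ∫ s in (0 : ℝ)..t, G s (dysonTerm G f k s)

theorem continuous_dysonTerm (hG : ∀ t x, ‖G t x‖ ≤ M * ‖x‖)
    (hc : ∀ x, Continuous fun t => G t x) (f : E) (k : ℕ) : Continuous (dysonTerm G f k) := by
  induction k with
  | zero => exact continuous_const
  | succ k ih =>
    exact intervalIntegral.continuous_primitive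
      (fun a b => (continuous_apply_of_bound hG hc ih).intervalIntegrable a b) 0

theorem hasDerivAt_dysonTerm_succ [CompleteSpace E] (hG : ∀ t x, ‖G t x‖ ≤ M * ‖x‖)
    (hc : ∀ x, Continuous fun t => G t x) (f : E) (k : ℕ) (t : ℝ) :
    HasDerivAt (dysonTerm G f (k + 1)) (G t (dysonTerm G f k t)) t := by
  have h := continuous_apply_of_bound hG hc (continuous_dysonTerm hG hc f k)
  exact intervalIntegral.integral_hasDerivAt_right (h.intervalIntegrable _ _)
    (h.stronglyMeasurableAtFilter _ _) h.continuousAt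

theorem norm_dysonTerm_le (hM : 0 ≤ M) (hG : ∀ t x, ‖G t x‖ ≤ M * ‖x‖)
    (hc : ∀ x, Continuous fun t => G t x) (f : E) (k : ℕ) (t : ℝ) :
    ‖dysonTerm G f k t‖ ≤ (M * |t|) ^ k / k.factorial * ‖f‖ := by
  induction k generalizing t with
  | zero => simp [dysonTerm]
  | succ k ih =>
    have h := continuous_apply_of_bound hG hc (continuous_dysonTerm hG hc f k)
    calc ‖dysonTerm G f (k + 1) t‖
        ≤ ∫ s in uIoc 0 t, ‖G s (dysonTerm G f k s)‖ :=
          intervalIntegral.norm_integral_le_integral_norm_uIoc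
      _ ≤ ∫ s in uIoc 0 t, M ^ (k + 1) / k.factorial * ‖f‖ * |s - 0| ^ k := by
          refine setIntegral_mono_on ?_ ?_ measurableSet_uIoc fun s _ => ?_
          · exact (h.norm.intervalIntegrable 0 t).def'
          · refine Continuous.integrableOn_uIoc ?_
            fun_prop
          · refine (hG s _).trans ((mul_le_mul_of_nonneg_left (ih s) hM).trans_eq ?_)
            rw [sub_zero, mul_pow]; ring
      _ = (M * |t|) ^ (k + 1) / (k + 1).factorial * ‖f‖ := by
          rw [integral_const_mul, integral_pow_abs_sub_uIoc, sub_zero, Nat.factorial_succ]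
          push_cast
          rw [mul_pow]
          field_simp

/-- The solution is the sum of the Dyson terms. The bound $(M|t|)^k/k!$ makes both the series and
its termwise derivative converge locally uniformly. -/
theorem exists_linear_ode_solution [CompleteSpace E] (hM : 0 ≤ M) (hG : ∀ t x, ‖G t x‖ ≤ M * ‖x‖)
    (hc : ∀ x, Continuous fun t => G t x) (f : E) :
    ∃ Y : ℝ → E, Y 0 = f ∧ (∀ t, HasDerivAt Y (G t (Y t)) t) ∧
      ∀ t, ‖Y t‖ ≤ Real.exp (M * |t|) * ‖f‖ := by
  have hb := norm_dysonTerm_le hM hG hc f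
  have hs : ∀ c : ℝ, Summable fun k : ℕ => c ^ k / k.factorial * ‖f‖ := fun c =>
    (Real.summable_pow_div_factorial c).mul_right _
  have hsum : ∀ t, Summable fun k => dysonTerm G f k t := fun t =>
    Summable.of_norm_bounded (hs _) fun k => hb k t
  refine ⟨fun t => ∑' k, dysonTerm G f k t, ?_, fun t => ?_, fun t => ?_⟩
  · refine (tsum_eq_single 0 ?_).trans ?_
    · intro k hk
      obtain ⟨k, rfl⟩ := Nat.exists_eq_succ_of_ne_zero hk
      simp [dysonTerm]
    · rfl
  · let g' : ℕ → ℝ → E := fun k s => Nat.casesOn k 0 fun k => G s (dysonTerm G f k s)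
    let u : ℕ → ℝ := fun k => Nat.casesOn k 0 fun k =>
      M * ((M * (|t| + 1)) ^ k / k.factorial * ‖f‖)
    have hu : Summable u := (summable_nat_add_iff 1).1 ((hs _).mul_left M)
    have h := hasDerivAt_tsum_of_isPreconnected (g := dysonTerm G f) (g' := g') (u := u)
      (t := Metric.ball 0 (|t| + 1)) (y₀ := 0) (y := t) hu Metric.isOpen_ball
      (convex_ball _ _).isPreconnected ?_ ?_ ?_ (hsum 0) ?_
    · convert h using 1
      have h1 : Summable fun k => g' k t := by
        refine (summable_nat_add_iff 1).1 ?_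
        exact (hsum t).mapL (G t)
      rw [h1.tsum_eq_zero_add, (G t).map_tsum (hsum t)]
      exact (zero_add _).symm
    · rintro (_ | k) s _
      · exact hasDerivAt_const s f
      · exact hasDerivAt_dysonTerm_succ hG hc f k s
    · rintro (_ | k) s hs
      · simp [g', u]
      · refine (hG s _).trans (mul_le_mul_of_nonneg_left ((hb k s).trans ?_) hM)
        have : |s| ≤ |t| + 1 := by simpa using (mem_ball_zero_iff.1 hs).le
        gcongr
    · exact Metric.mem_ball_self (by positivity)
    · simp
  · refine (tsum_of_norm_bounded (hs (M * |t|)).hasSum fun k => hb k t).trans_eq ?_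
    rw [tsum_mul_right, Real.exp_eq_exp_ℝ, NormedSpace.exp_eq_tsum_div]

theorem linear_ode_solution_unique (hG : ∀ t x, ‖G t x‖ ≤ M * ‖x‖) {Y Z : ℝ → E}
    (hY : ∀ t, HasDerivAt Y (G t (Y t)) t) (hZ : ∀ t, HasDerivAt Z (G t (Z t)) t)
    (h0 : Y 0 = Z 0) : Y = Z := by
  refine ODE_solution_unique_univ (v := fun t x => G t x) (s := fun _ => univ) (K := M.toNNReal)
    (fun t => ?_) (fun t => ⟨hY t, mem_univ _⟩) (fun t => ⟨hZ t, mem_univ _⟩) h0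
  refine LipschitzOnWith.of_dist_le_mul fun x _ y _ => ?_
  rw [dist_eq_norm, dist_eq_norm, ← map_sub]
  refine (hG t _).trans ?_
  gcongr
  exact Real.le_coe_toNNReal M

end Dyson

/-! ### Bounded perturbations and symmetries of groups -/

section Perturbation

variable {E : Type*} [NormedAddCommGroup E] [NormedSpace ℂ E]
  {A : E → E → Prop} {U : ℝ → E →L[ℂ] E}

/-- Composing a group with a family that is differentiable at `0` changes the generator by a
bounded operator. -/
theorem IsGroupGeneratedBy.hasDerivAt_comp_iff [CompleteSpace E] (hU : IsGroupGeneratedBy A U) {Y : ℝ → E} {u w : E}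
    (hY0 : Y 0 = u) (hY : HasDerivAt Y (Complex.I • w) 0) (v : E) :
    HasDerivAt (fun t => U t (Y t)) (Complex.I • v) 0 ↔ A u (v - w) := by
  have h1 : HasDerivAt (fun t => U t (Y t - u)) (Complex.I • w) 0 := by
    rw [hasDerivAt_iff_tendsto_slope] at hY ⊢
    have h2 := hU.tendsto_apply (f := id) (s := 0) (l := 𝓝[≠] 0)
      (tendsto_id.mono_left nhdsWithin_le_nhds) hY
    rw [hU.zero] at h2
    refine h2.congr fun t => ?_
    simp only [slope_def_module, hY0, sub_self, map_zero, sub_zero, id]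
    rw [← Complex.coe_smul, ← Complex.coe_smul, map_smul]
  rw [← hU.gen u (v - w), smul_sub]
  constructor
  · intro h
    refine (h.sub h1).congr_of_eventuallyEq (Eventually.of_forall fun t => ?_)
    simp
  · intro h
    have := h.add h1
    rw [sub_add_cancel] at this
    refine this.congr_of_eventuallyEq (Eventually.of_forall fun t => ?_)
    simp

theorem IsGroupGeneratedBy.neg_apply_apply (hU : IsGroupGeneratedBy A U) (t : ℝ) (x : E) :
    U (-t) (U t x) = x := by
  have := congrArg (fun w : E →L[ℂ] E => w x) (hU.add (-t) t)
  simpa [hU.zero] using this.symm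

theorem IsGroupGeneratedBy.apply_neg_apply (hU : IsGroupGeneratedBy A U) (t : ℝ) (x : E) :
    U t (U (-t) x) = x := by
  simpa using hU.neg_apply_apply (-t) x

/-- Bounded perturbations of isometric groups. The orbits of the perturbed group in the interaction
picture are differentiable, without any condition on the initial value. -/
theorem IsGroupGeneratedBy.exists_perturbation [CompleteSpace E] (hU : IsGroupGeneratedBy A U)
    (hiso : ∀ t x, ‖U t x‖ = ‖x‖) (B : E →L[ℂ] E) :
    ∃ V : ℝ → E →L[ℂ] E, IsGroupGeneratedBy (fun u v => A u (v - B u)) V ∧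
      ∀ f t, HasDerivAt (fun s => U (-s) (V s f)) (U (-t) (Complex.I • B (V t f))) t := by
  -- The perturbation in the interaction picture, $U(-t)\,iB\,U(t)$: bounded by $\|B\|$ and strongly
  -- continuous even though $A$ is unbounded.
  let G : ℝ → E →L[ℂ] E := fun t => (U (-t)).comp ((Complex.I • B).comp (U t))
  have hGa : ∀ t x, G t x = U (-t) (Complex.I • B (U t x)) := fun t x => rfl
  have hG : ∀ t x, ‖G t x‖ ≤ ‖B‖ * ‖x‖ := fun t x => by
    rw [hGa, hiso, norm_smul, Complex.norm_I, one_mul, ← hiso t x]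
    exact B.le_opNorm _
  have hc : ∀ x, Continuous fun t => G t x := fun x => by
    have h1 : Continuous fun t : ℝ => Complex.I • B (U t x) :=
      (B.continuous.comp (hU.cont x)).const_smul _
    exact continuous_apply_of_bound (G := fun t => U (-t)) (M := 1) (fun t x => by simp [hiso])
      (fun x => (hU.cont x).comp continuous_neg) h1
  choose Y hY0 hY hYb using exists_linear_ode_solution (norm_nonneg B) hG hc
  have huniq : ∀ {Z : ℝ → E} {f : E}, (∀ t, HasDerivAt Z (G t (Z t)) t) → Z 0 = f → Y f = Z :=
    fun hZ h0 => linear_ode_solution_unique hG (hY _) hZ ((hY0 _).trans h0.symm)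
  have hadd : ∀ f g t, Y (f + g) t = Y f t + Y g t := fun f g t => by
    refine congrFun (huniq (Z := fun t => Y f t + Y g t) (fun s => ?_) (by simp [hY0])) t
    rw [map_add]
    exact (hY f s).add (hY g s)
  have hsmul : ∀ (c : ℂ) f t, Y (c • f) t = c • Y f t := fun c f t => by
    refine congrFun (huniq (Z := fun t => c • Y f t) (fun s => ?_) (by simp [hY0])) t
    rw [map_smul]
    exact (hY f s).const_smul c
  let V : ℝ → E →L[ℂ] E := fun t => (U t).comp
    (LinearMap.mkContinuous (σ := RingHom.id ℂ) ⟨⟨fun f => Y f t, fun f g => hadd f g t⟩, fun c f => hsmul c f t⟩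
      (Real.exp (‖B‖ * |t|)) fun f => hYb f t)
  have hV : ∀ t f, V t f = U t (Y f t) := fun t f => rfl
  refine ⟨V, ⟨?_, ?_, ?_, ?_⟩, ?_⟩
  · ext f
    simp [hV, hU.zero, hY0]
  · intro s t
    ext f
    -- The group law follows from uniqueness for the differential equation: the translated solution,
    -- carried by $U(t)$, solves the same equation from $V(t)f$.
    have h1 : Y (V t f) = fun r => U t (Y f (r + t)) := by
      refine huniq (fun r => ?_) (by simp [hV])
      have h2 := ((U t).restrictScalars ℝ).hasFDerivAt.comp_hasDerivAt r
        ((hY f (r + t)).comp_add_const r t)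
      have h3 : G r (U t (Y f (r + t))) = U t (G (r + t) (Y f (r + t))) := by
        rw [hGa, hGa, neg_add_rev, hU.add r t, hU.add (-t) (-r)]
        exact (hU.apply_neg_apply t _).symm
      rw [h3]
      exact h2
    change V (s + t) f = V s (V t f)
    rw [hV s (V t f), h1, hV, hU.add]
    rfl
  · intro f
    have hYc : Continuous (Y f) := continuous_iff_continuousAt.2 fun t => (hY f t).continuousAt
    exact continuous_apply_of_bound (M := 1) (fun t x => by simp [hiso]) hU.cont hYc
  · intro u v
    have h1 := hY u 0
    rw [hY0, hGa, neg_zero, hU.zero] at h1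
    exact hU.hasDerivAt_comp_iff (hY0 u) h1 v
  · intro f t
    have h1 : (fun s => U (-s) (V s f)) = Y f := funext fun s => by
      rw [hV, hU.neg_apply_apply]
    rw [h1]
    exact hY f t

/-- A group is transported by a bounded symmetry of its generator. -/
theorem IsGroupGeneratedBy.commute_of_symm [CompleteSpace E] (hU : IsGroupGeneratedBy A U) {T T' : E →L[ℂ] E}
    (hT : ∀ x, T (T' x) = x) (hT' : ∀ x, T' (T x) = x) (hA : ∀ u v, A (T u) (T v) ↔ A u v)
    (t : ℝ) (x : E) : U t (T x) = T (U t x) := by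
  -- The conjugated group has the same generator, so it equals $U$ by uniqueness.
  have h : IsGroupGeneratedBy A fun t => T'.comp ((U t).comp T) := by
    refine ⟨?_, ?_, fun u => ?_, fun u v => ?_⟩
    · ext x; simp [hU.zero, hT']
    · intro s t
      ext x
      simp [hU.add, hT]
    · exact T'.continuous.comp (hU.cont _)
    · rw [← hA, ← hU.gen]
      have hd : ∀ (R : E →L[ℂ] E) {g : ℝ → E} {d : E}, HasDerivAt g d 0 →
          HasDerivAt (fun t => R (g t)) (R d) 0 := fun R g d hg =>
        (R.restrictScalars ℝ).hasFDerivAt.comp_hasDerivAt 0 hg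
      constructor
      · intro h
        simpa [hT] using hd T h
      · intro h
        have := hd T' h
        rw [map_smul, hT'] at this
        exact this
  have h1 := congrFun (hU.unique h) t
  nth_rewrite 2 [h1]
  simp [hT]

end Perturbation

/-! ### Exponential decay of the profile and of the potential -/

section Decay

/-- Nonnegative solutions of `κ² y ≤ y''` that tend to zero decay exponentially. -/
theorem exp_decay_of_deriv2_ge {y y' y'' : ℝ → ℝ} {κ R : ℝ} (hκ : 0 < κ)
    (h1 : ∀ x, HasDerivAt y (y' x) x) (h2 : ∀ x, HasDerivAt y' (y'' x) x)
    (hy : ∀ x, R ≤ x → κ ^ 2 * y x ≤ y'' x) (hlim : Tendsto y atTop (𝓝 0)) {x : ℝ} (hx : R ≤ x) :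
    y x ≤ y R * Real.exp (κ * R) * Real.exp (-(κ * x)) := by
  have hexp : ∀ c x : ℝ, HasDerivAt (fun x => Real.exp (c * x)) (Real.exp (c * x) * c) x :=
    fun c x => by simpa using ((hasDerivAt_id x).const_mul c).exp
  -- The growing mode is excluded. As $e^{-\kappa x}(y'+\kappa y)$ is nondecreasing, a positive
  -- value $c$ of $y'+\kappa y$ at $a$ would persist as a lower bound; once $\kappa y\le c/2$ this
  -- forces $y'\ge c/2$, contradicting $y\to0$.
  have hg : ∀ x, R ≤ x → y' x + κ * y x ≤ 0 := by
    intro a ha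
    by_contra! hc
    set c := y' a + κ * y a
    have hmono : MonotoneOn (fun x => Real.exp (-κ * x) * (y' x + κ * y x)) (Ici R) := by
      have hd : ∀ x, HasDerivAt (fun x => Real.exp (-κ * x) * (y' x + κ * y x))
          (Real.exp (-κ * x) * -κ * (y' x + κ * y x)
            + Real.exp (-κ * x) * (y'' x + κ * y' x)) x := fun x =>
        (hexp (-κ) x).mul ((h2 x).add ((h1 x).const_mul κ))
      refine monotoneOn_of_deriv_nonneg (convex_Ici R)
        (fun x _ => (hd x).continuousAt.continuousWithinAt)
        (fun x _ => (hd x).differentiableAt.differentiableWithinAt) fun x hx => ?_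
      rw [interior_Ici] at hx
      rw [(hd x).deriv]
      have : Real.exp (-κ * x) * -κ * (y' x + κ * y x) + Real.exp (-κ * x) * (y'' x + κ * y' x)
          = Real.exp (-κ * x) * (y'' x - κ ^ 2 * y x) := by ring
      rw [this]
      exact mul_nonneg (Real.exp_pos _).le (sub_nonneg.2 (hy x hx.le))
    have hge : ∀ x, a ≤ x → c ≤ y' x + κ * y x := by
      intro x hx
      have h3 := hmono ha (ha.trans hx) hx
      have h4 : c ≤ Real.exp (κ * (x - a)) * c :=
        le_mul_of_one_le_left hc.le (Real.one_le_exp (mul_nonneg hκ.le (sub_nonneg.2 hx)))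
      have h5 : Real.exp (κ * x) * (Real.exp (-κ * a) * c) ≤
          Real.exp (κ * x) * (Real.exp (-κ * x) * (y' x + κ * y x)) :=
        mul_le_mul_of_nonneg_left h3 (Real.exp_pos _).le
      rw [← mul_assoc, ← mul_assoc, ← Real.exp_add, ← Real.exp_add] at h5
      have e1 : κ * x + -κ * a = κ * (x - a) := by ring
      have e2 : κ * x + -κ * x = 0 := by ring
      rw [e1, e2, Real.exp_zero, one_mul] at h5
      exact h4.trans h5
    have hsmall : ∀ᶠ x in atTop, y x < c / (2 * κ) :=
      hlim.eventually (gt_mem_nhds (by positivity))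
    obtain ⟨b, hb⟩ := (hsmall.and (eventually_ge_atTop a)).exists_forall_of_atTop
    have hmono2 : MonotoneOn (fun x => y x - c / 2 * x) (Ici b) := by
      have hd : ∀ x, HasDerivAt (fun x => y x - c / 2 * x) (y' x - c / 2 * 1) x := fun x =>
        (h1 x).sub ((hasDerivAt_id x).const_mul (c / 2))
      refine monotoneOn_of_deriv_nonneg (convex_Ici b)
        (fun x _ => (hd x).continuousAt.continuousWithinAt)
        (fun x _ => (hd x).differentiableAt.differentiableWithinAt) fun x hx => ?_
      rw [interior_Ici] at hx
      rw [(hd x).deriv]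
      obtain ⟨h3, h4⟩ := hb x hx.le
      have h5 := hge x h4
      have h6 : κ * y x ≤ c / 2 := by
        have := mul_le_mul_of_nonneg_left h3.le hκ.le
        have e : κ * (c / (2 * κ)) = c / 2 := by field_simp
        rwa [e] at this
      linarith
    have hbot : Tendsto (fun x => y x - c / 2 * x) atTop atBot := by
      have : Tendsto (fun x : ℝ => -(c / 2 * x)) atTop atBot :=
        tendsto_neg_atTop_atBot.comp (tendsto_id.const_mul_atTop (by positivity))
      simpa [sub_eq_add_neg] using hlim.add_atBot this
    obtain ⟨d, hd1, hd2⟩ := ((hbot.eventually (eventually_lt_atBot (y b - c / 2 * b))).and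
      (eventually_ge_atTop b)).exists
    exact absurd (hmono2 self_mem_Ici hd2 hd2) (not_le.2 hd1)
  have hanti : AntitoneOn (fun x => Real.exp (κ * x) * y x) (Ici R) := by
    have hd : ∀ x, HasDerivAt (fun x => Real.exp (κ * x) * y x)
        (Real.exp (κ * x) * κ * y x + Real.exp (κ * x) * y' x) x := fun x =>
      (hexp κ x).mul (h1 x)
    refine antitoneOn_of_deriv_nonpos (convex_Ici R)
      (fun x _ => (hd x).continuousAt.continuousWithinAt)
      (fun x _ => (hd x).differentiableAt.differentiableWithinAt) fun x hx => ?_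
    rw [interior_Ici] at hx
    rw [(hd x).deriv]
    have : Real.exp (κ * x) * κ * y x + Real.exp (κ * x) * y' x
        = Real.exp (κ * x) * (y' x + κ * y x) := by ring
    rw [this]
    exact mul_nonpos_of_nonneg_of_nonpos (Real.exp_pos _).le (hg x hx.le)
  have h3 : Real.exp (κ * x) * y x ≤ Real.exp (κ * R) * y R := hanti self_mem_Ici hx hx
  have h4 := mul_le_mul_of_nonneg_right h3 (Real.exp_pos (-(κ * x))).le
  have e : Real.exp (κ * x) * y x * Real.exp (-(κ * x)) = y x := by
    rw [mul_right_comm, ← Real.exp_add, add_neg_cancel, Real.exp_zero, one_mul]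
  rw [e] at h4
  exact h4.trans_eq (by ring)

theorem rho_pos (x : ℝ) : 0 < rho x := by unfold rho; positivity

theorem rho_le_one (x : ℝ) : rho x ≤ 1 :=
  inv_le_one_of_one_le₀ (by linarith [abs_nonneg x])

theorem rho_sub_le (x b : ℝ) : rho (x - b) ≤ (1 + |b|) * rho x := by
  unfold rho
  rw [inv_le_iff_one_le_mul₀ (by positivity), mul_right_comm, ← div_eq_mul_inv,
    le_div_iff₀ (by positivity)]
  have h1 : |x| ≤ |x - b| + |b| := by simpa using abs_add_le (x - b) b
  nlinarith [abs_nonneg b, abs_nonneg (x - b)]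

/-- The square of the inequality $1+s\le e^s$ at $s=\kappa|x|/2$. -/
theorem exp_neg_le_rho_sq {κ : ℝ} (hκ : 0 < κ) (x : ℝ) :
    Real.exp (-(κ * |x|)) ≤ (1 + 2 / κ) ^ 2 * rho x ^ 2 := by
  have h1 : 1 + κ * |x| / 2 ≤ Real.exp (κ * |x| / 2) := by
    linarith [Real.add_one_le_exp (κ * |x| / 2)]
  have h2 : 1 + |x| ≤ (1 + 2 / κ) * Real.exp (κ * |x| / 2) := by
    have e : (1 + 2 / κ) * (1 + κ * |x| / 2) = 1 + |x| + 2 / κ + κ * |x| / 2 := by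
      field_simp; ring
    have h3 : (1 + 2 / κ) * (1 + κ * |x| / 2) ≤ (1 + 2 / κ) * Real.exp (κ * |x| / 2) := by gcongr
    have h4 : 0 ≤ 2 / κ + κ * |x| / 2 := by positivity
    linarith
  unfold rho
  rw [inv_pow, ← div_eq_mul_inv, le_div_iff₀ (by positivity), Real.exp_neg, inv_mul_le_iff₀
    (Real.exp_pos _)]
  have e : Real.exp (κ * |x|) = Real.exp (κ * |x| / 2) ^ 2 := by
    rw [← Real.exp_nat_mul]; congr 1; push_cast; ring
  rw [e, ← mul_pow, mul_comm (Real.exp _)]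
  gcongr

variable {F : ℝ → ℝ} {α : ℝ} {φ : ℝ → ℝ}

/-- Working with $y=\varphi^2$ avoids any discussion of the sign of $\varphi$:
$y''\ge2\varphi\varphi''=2(\kappa^2+F(y))y\ge\kappa^2y$ as soon as $F(y)\ge-\kappa^2/2$. The decay
estimate is applied on both half-lines, and compactness covers the middle. -/
theorem IsProfile.exists_sq_le (hF : ContinuousWithinAt F (Ici 0) 0) (hF0 : F 0 = 0) (hα : 0 < α)
    (hφ : IsProfile F α φ) : ∃ C, ∀ x, φ x ^ 2 ≤ C * rho x ^ 2 := by
  have hd1 : ∀ x, HasDerivAt φ (deriv φ x) x := fun x =>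
    (hφ.contDiff.differentiable (by norm_num) x).hasDerivAt
  have hd2 : ∀ x, HasDerivAt (deriv φ) (deriv (deriv φ) x) x := fun x => by
    have h : ContDiff ℝ 1 (deriv φ) :=
      ((contDiff_succ_iff_deriv (n := 1)).1 (by rw [one_add_one_eq_two]; exact hφ.contDiff)).2.2
    exact (h.differentiable (by norm_num) x).hasDerivAt
  set κ := α / 2 with hκ
  have hκ0 : 0 < κ := by positivity
  have hsq : Tendsto (fun x => φ x ^ 2) (cocompact ℝ) (𝓝 0) := by simpa using hφ.decay.pow 2
  have hFt : ∀ᶠ x in cocompact ℝ, -(κ ^ 2 / 2) < F (φ x ^ 2) := by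
    have h1 : Tendsto (fun x => φ x ^ 2) (cocompact ℝ) (𝓝[Ici 0] 0) :=
      tendsto_nhdsWithin_iff.2 ⟨hsq, Eventually.of_forall fun x => sq_nonneg (φ x)⟩
    have h2 := hF.tendsto.comp h1
    rw [hF0] at h2
    exact h2.eventually (lt_mem_nhds (neg_lt_zero.2 (by positivity)))
  rw [cocompact_eq_atBot_atTop, eventually_sup] at hFt
  obtain ⟨a, ha⟩ := eventually_atBot.1 hFt.1
  obtain ⟨b, hb⟩ := eventually_atTop.1 hFt.2
  set R := max (|a|) (|b|) with hR
  have hFR : ∀ x, R ≤ |x| → -(κ ^ 2 / 2) < F (φ x ^ 2) := by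
    intro x hx
    rcases le_total 0 x with h | h
    · rw [abs_of_nonneg h] at hx
      exact hb x ((le_abs_self b).trans ((le_max_right _ _).trans hx))
    · rw [abs_of_nonpos h] at hx
      exact ha x (by linarith [neg_abs_le a, le_max_left |a| |b|])
  have hR0 : 0 ≤ R := (abs_nonneg a).trans (le_max_left _ _)
  have hy1 : ∀ x, HasDerivAt (fun x => φ x ^ 2) (2 * φ x * deriv φ x) x := fun x =>
    ((hd1 x).pow 2).congr_deriv (by simp)
  have hy2 : ∀ x, HasDerivAt (fun x => 2 * φ x * deriv φ x)
      (2 * deriv φ x * deriv φ x + 2 * φ x * deriv (deriv φ) x) x := fun x =>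
    ((hd1 x).const_mul 2).mul (hd2 x)
  have hineq : ∀ x, R ≤ |x| →
      κ ^ 2 * φ x ^ 2 ≤ 2 * deriv φ x * deriv φ x + 2 * φ x * deriv (deriv φ) x := by
    intro x hx
    rw [hφ.ode x]
    have h1 := mul_le_mul_of_nonneg_right (hFR x hx).le (sq_nonneg (φ x))
    have h2 : α ^ 2 / 4 = κ ^ 2 := by rw [hκ]; ring
    rw [h2]
    nlinarith [sq_nonneg (deriv φ x)]
  have hright : ∀ x, R ≤ x →
      φ x ^ 2 ≤ φ R ^ 2 * Real.exp (κ * R) * Real.exp (-(κ * x)) := fun x hx =>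
    exp_decay_of_deriv2_ge hκ0 hy1 hy2 (fun x hx => hineq x (hx.trans (le_abs_self x)))
      (hsq.mono_left atTop_le_cocompact) hx
  have hleft : ∀ x, R ≤ x →
      φ (-x) ^ 2 ≤ φ (-R) ^ 2 * Real.exp (κ * R) * Real.exp (-(κ * x)) := fun x hx => by
    have h1 : ∀ x, HasDerivAt (fun x => φ (-x) ^ 2) (-(2 * φ (-x) * deriv φ (-x))) x := fun x =>
      ((hy1 (-x)).scomp x (hasDerivAt_neg x)).congr_deriv (by simp)
    have h2 : ∀ x, HasDerivAt (fun x => -(2 * φ (-x) * deriv φ (-x)))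
        (2 * deriv φ (-x) * deriv φ (-x) + 2 * φ (-x) * deriv (deriv φ) (-x)) x := fun x =>
      ((hy2 (-x)).scomp x (hasDerivAt_neg x)).neg.congr_deriv (by simp)
    exact exp_decay_of_deriv2_ge (y := fun x => φ (-x) ^ 2) hκ0 h1 h2
      (fun x hx => hineq (-x) (by rw [abs_neg]; exact hx.trans (le_abs_self x)))
      ((hsq.mono_left atBot_le_cocompact).comp tendsto_neg_atTop_atBot) hx
  obtain ⟨C1, hC1⟩ := (isCompact_Icc (a := -R) (b := R)).exists_bound_of_continuousOn
    (f := fun x => φ x ^ 2) fun x _ => (hy1 x).continuousAt.continuousWithinAt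
  set C2 := φ R ^ 2 * Real.exp (κ * R)
  set C3 := φ (-R) ^ 2 * Real.exp (κ * R)
  have hC1' : 0 ≤ C1 := (norm_nonneg _).trans (hC1 0 ⟨by linarith, hR0⟩)
  have hC2 : 0 ≤ C2 := by positivity
  have hC3 : 0 ≤ C3 := by positivity
  have hall : ∀ x, φ x ^ 2 ≤ (C1 * Real.exp (κ * R) + C2 + C3) * Real.exp (-(κ * |x|)) := by
    intro x
    have hp := Real.exp_pos (-(κ * |x|))
    have hp1 := Real.exp_pos (κ * R)
    rcases le_total R |x| with h | h
    · rcases le_total 0 x with h0 | h0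
      · have h1 := hright |x| h
        rw [abs_of_nonneg h0] at h1 ⊢
        refine h1.trans (mul_le_mul_of_nonneg_right ?_ (Real.exp_pos _).le)
        have := mul_nonneg hC1' hp1.le
        linarith
      · have h1 := hleft |x| h
        rw [abs_of_nonpos h0, neg_neg] at h1
        rw [abs_of_nonpos h0]
        refine h1.trans (mul_le_mul_of_nonneg_right ?_ (Real.exp_pos _).le)
        have := mul_nonneg hC1' hp1.le
        linarith
    · have h1 := (le_abs_self _).trans (hC1 x (abs_le.1 h))
      have h2 : 1 ≤ Real.exp (κ * R) * Real.exp (-(κ * |x|)) := by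
        rw [← Real.exp_add]
        exact Real.one_le_exp (by nlinarith)
      have h3 : C1 ≤ C1 * (Real.exp (κ * R) * Real.exp (-(κ * |x|))) := le_mul_of_one_le_right hC1' h2
      have h4 := mul_nonneg hC2 hp.le
      have h5 := mul_nonneg hC3 hp.le
      nlinarith
  refine ⟨(C1 * Real.exp (κ * R) + C2 + C3) * (1 + 2 / κ) ^ 2, fun x => (hall x).trans ?_⟩
  rw [mul_assoc]
  refine mul_le_mul_of_nonneg_left (exp_neg_le_rho_sq hκ0 x) ?_
  positivity

/-- With $K$ bounding $|F'|$ on the range $[0,C]$ of $\varphi^2$, the mean value inequality and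
$F(0)=0$ give $|F(\varphi^2)|\le K\varphi^2$, so both coefficients inherit the decay of $\varphi^2$.
-/
theorem IsProfile.exists_coeff_bound (hF : ContDiffOn ℝ ∞ F (Ici 0)) (hF0 : F 0 = 0) (hα : 0 < α)
    (hφ : IsProfile F α φ) : Continuous (diagCoeff F φ) ∧ Continuous (offDiagCoeff F φ) ∧
      ∃ C, ∀ x, |diagCoeff F φ x| ≤ C * rho x ^ 2 ∧ |offDiagCoeff F φ x| ≤ C * rho x ^ 2 := by
  have hφc : Continuous fun x => φ x ^ 2 := hφ.contDiff.continuous.pow 2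
  have hmem : ∀ x, φ x ^ 2 ∈ Ici (0 : ℝ) := fun x => sq_nonneg (φ x)
  have hdc : ContinuousOn (derivWithin F (Ici 0)) (Ici 0) :=
    hF.continuousOn_derivWithin (uniqueDiffOn_Ici 0) (by norm_num)
  have hoff : Continuous (offDiagCoeff F φ) :=
    (hdc.comp_continuous hφc hmem).mul hφc
  have hFc : Continuous fun x => F (φ x ^ 2) := hF.continuousOn.comp_continuous hφc hmem
  refine ⟨hFc.add hoff, hoff, ?_⟩
  obtain ⟨C, hC⟩ := hφ.exists_sq_le (hF.continuousOn 0 self_mem_Ici) hF0 hα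
  have hC0 : 0 ≤ C := by
    have h := (sq_nonneg _).trans (hC 0)
    simpa [rho] using h
  have hCx : ∀ x, φ x ^ 2 ≤ C := fun x => (hC x).trans <|
    mul_le_of_le_one_right hC0 (pow_le_one₀ (rho_pos x).le (rho_le_one x))
  obtain ⟨K, hK⟩ := (isCompact_Icc (a := 0) (b := C)).exists_bound_of_continuousOn
    (hdc.mono Icc_subset_Ici_self)
  have hK0 : 0 ≤ K := (norm_nonneg _).trans (hK 0 ⟨le_rfl, hC0⟩)
  have hoffb : ∀ x, |offDiagCoeff F φ x| ≤ K * φ x ^ 2 := fun x => by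
    rw [offDiagCoeff, abs_mul, abs_of_nonneg (sq_nonneg (φ x))]
    exact mul_le_mul_of_nonneg_right (hK _ ⟨hmem x, hCx x⟩) (hmem x)
  have hFb : ∀ x, |F (φ x ^ 2)| ≤ K * φ x ^ 2 := fun x => by
    have h := (convex_Icc (0 : ℝ) C).norm_image_sub_le_of_norm_hasDerivWithin_le (f := F)
      (f' := derivWithin F (Ici 0)) (C := K) (x := 0) (y := φ x ^ 2)
      (fun s hs => ((hF.differentiableOn (by norm_num) s hs.1).hasDerivWithinAt.mono
        Icc_subset_Ici_self)) hK ⟨le_rfl, hC0⟩ ⟨hmem x, hCx x⟩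
    simpa [hF0] using h
  have hKb : ∀ x, K * φ x ^ 2 ≤ K * C * rho x ^ 2 := fun x => by
    rw [mul_assoc]; exact mul_le_mul_of_nonneg_left (hC x) hK0
  refine ⟨2 * (K * C), fun x => ⟨?_, ?_⟩⟩
  · refine (abs_add_le _ _).trans ?_
    linarith [hoffb x, hFb x, hKb x]
  · have := mul_nonneg (mul_nonneg hK0 hC0) (sq_nonneg (rho x))
    linarith [hoffb x, hKb x]

end Decay

/-! ### Integration by parts for primitives of integrable functions -/

section Primitive

/-- Increments of the primitive are dominated by those of the primitive of $|p|$. -/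
theorem absolutelyContinuousOnInterval_primitive {p : ℝ → ℂ} {R : ℝ}
    (hp : IntervalIntegrable p volume 0 R) :
    AbsolutelyContinuousOnInterval (fun x => ∫ s in (0 : ℝ)..x, p s) 0 R := by
  have h := hp.norm.absolutelyContinuousOnInterval_intervalIntegral left_mem_uIcc
  have hp0 : ∀ x ∈ uIcc 0 R, IntervalIntegrable p volume 0 x := fun x hx =>
    hp.mono_set (uIcc_subset_uIcc left_mem_uIcc hx)
  refine squeeze_zero' (Eventually.of_forall fun E => Finset.sum_nonneg fun i _ => dist_nonneg) ?_ h
  rw [eventually_inf_principal]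
  refine Eventually.of_forall fun E hE => Finset.sum_le_sum fun i hi => ?_
  obtain ⟨h1, h2⟩ := hE.1 i hi
  rw [dist_eq_norm, dist_eq_norm, intervalIntegral.integral_interval_sub_left (hp0 _ h1) (hp0 _ h2),
    intervalIntegral.integral_interval_sub_left (hp0 _ h1).norm (hp0 _ h2).norm]
  exact intervalIntegral.norm_integral_le_abs_integral_norm

/-- The product and the primitive of the integrand are absolutely continuous with the same
derivative almost everywhere, so they differ by a constant. -/
theorem integral_primitive_mul_primitive {p q : ℝ → ℂ} {a c : ℂ} {R : ℝ}
    (hp : IntervalIntegrable p volume 0 R) (hq : IntervalIntegrable q volume 0 R) :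
    ∫ x in (0 : ℝ)..R, (p x * (c + ∫ s in (0 : ℝ)..x, q s) + (a + ∫ s in (0 : ℝ)..x, p s) * q x)
      = (a + ∫ s in (0 : ℝ)..R, p s) * (c + ∫ s in (0 : ℝ)..R, q s) - a * c := by
  have hcst : ∀ a : ℂ, AbsolutelyContinuousOnInterval (fun _ : ℝ => a) 0 R := fun a =>
    (LipschitzWith.const a).lipschitzOnWith.absolutelyContinuousOnInterval
  have hP : AbsolutelyContinuousOnInterval (fun x => a + ∫ s in (0 : ℝ)..x, p s) 0 R :=
    (hcst a).add (absolutelyContinuousOnInterval_primitive hp)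
  have hQ : AbsolutelyContinuousOnInterval (fun x => c + ∫ s in (0 : ℝ)..x, q s) 0 R :=
    (hcst c).add (absolutelyContinuousOnInterval_primitive hq)
  have hg : IntervalIntegrable (fun x => p x * (c + ∫ s in (0 : ℝ)..x, q s)
      + (a + ∫ s in (0 : ℝ)..x, p s) * q x) volume 0 R :=
    (hp.mul_continuousOn hQ.continuousOn).add (hq.continuousOn_mul hP.continuousOn)
  have hf := (hP.fun_smul hQ).fun_sub (absolutelyContinuousOnInterval_primitive hg)
  obtain ⟨C, hC⟩ := hf.const_of_ae_hasDerivAt_zero (by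
    filter_upwards [hp.ae_hasDerivAt_integral, hq.ae_hasDerivAt_integral,
      hg.ae_hasDerivAt_integral] with x h1 h2 h3 hx
    have e1 := (h1 hx 0 left_mem_uIcc).const_add a
    have e2 := (h2 hx 0 left_mem_uIcc).const_add c
    exact ((e1.mul e2).sub (h3 hx 0 left_mem_uIcc)).congr_deriv (by ring))
  have h0 := hC 0 left_mem_uIcc
  have hR := hC R right_mem_uIcc
  rw [← h0] at hR
  simp only [smul_eq_mul] at hR
  rw [intervalIntegral.integral_same, intervalIntegral.integral_same,
    intervalIntegral.integral_same] at hR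
  linear_combination -hR

theorem ae_eq_zero_of_primitive_const {f : ℝ → ℂ}
    (hf : ∀ R, 0 < R → IntervalIntegrable f volume 0 R) {c : ℂ}
    (h : ∀ x, 0 < x → ∫ s in (0 : ℝ)..x, f s = c) : ∀ᵐ x ∂edgeMeasure, f x = 0 := by
  have h1 : ∀ᵐ x : ℝ, ∀ n : ℕ, x ∈ uIcc (0 : ℝ) (n + 1) →
      ∀ c ∈ uIcc (0 : ℝ) (n + 1), HasDerivAt (fun x => ∫ t in c..x, f t) (f x) x :=
    ae_all_iff.2 fun n => (hf (n + 1) (by positivity)).ae_hasDerivAt_integral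
  rw [ae_restrict_iff' measurableSet_Ioi]
  filter_upwards [h1] with x hx hx0
  obtain ⟨n, hn⟩ := exists_nat_ge x
  have h2 := hx n (by rw [uIcc_of_le (by positivity)]; exact ⟨hx0.le, by linarith⟩) 0 left_mem_uIcc
  refine h2.unique ((hasDerivAt_const x c).congr_of_eventuallyEq ?_)
  filter_upwards [Ioi_mem_nhds hx0] with y hy using h y hy

end Primitive

/-! ### First derivatives on a single edge -/

section Edge

theorem EdgeL2.intervalIntegrable (u : EdgeL2) {R : ℝ} (hR : 0 < R) :
    IntervalIntegrable u volume 0 R := by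
  rw [intervalIntegrable_iff_integrableOn_Ioc_of_le hR.le]
  have h : MemLp u 2 (volume.restrict (Ioc 0 R)) :=
    (Lp.memLp u).mono_measure (Measure.restrict_mono_set _ Ioc_subset_Ioi_self)
  exact h.integrable (by norm_num)

theorem edgeMeasure_Ioc_ne_top (y : ℝ) : edgeMeasure (Ioc 0 y) ≠ ⊤ :=
  ((Measure.restrict_le_self _).trans_lt measure_Ioc_lt_top).ne

/-- The indicator function of `(0, y]`. -/
noncomputable def edgeBox (y : ℝ) : EdgeL2 :=
  indicatorConstLp 2 (measurableSet_Ioc (a := 0) (b := y)) (edgeMeasure_Ioc_ne_top y) 1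

theorem memLp_edgeHat (y : ℝ) :
    MemLp ((Ioc 0 y).indicator fun s : ℝ => ((y - s : ℝ) : ℂ)) 2 edgeMeasure := by
  rw [memLp_indicator_iff_restrict measurableSet_Ioc]
  have : IsFiniteMeasure (edgeMeasure.restrict (Ioc 0 y)) :=
    ⟨by rw [Measure.restrict_apply_univ]
        exact (Measure.restrict_le_self _).trans_lt measure_Ioc_lt_top⟩
  refine MemLp.of_bound (by fun_prop) |y| ?_
  rw [ae_restrict_iff' measurableSet_Ioc]
  refine Eventually.of_forall fun s hs => ?_
  rw [Complex.norm_real, Real.norm_eq_abs, abs_of_nonneg (sub_nonneg.2 hs.2)]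
  linarith [hs.1, le_abs_self y]

/-- The hat function `s ↦ (y - s)₊`. -/
noncomputable def edgeHat (y : ℝ) : EdgeL2 := (memLp_edgeHat y).toLp _

theorem edgeMeasure_restrict_Ioc (y : ℝ) :
    edgeMeasure.restrict (Ioc 0 y) = volume.restrict (Ioc 0 y) := by
  rw [Measure.restrict_restrict measurableSet_Ioc, inter_eq_left.2 Ioc_subset_Ioi_self]

theorem inner_edgeBox (y : ℝ) (hy : 0 ≤ y) (u : EdgeL2) :
    inner ℂ (edgeBox y) u = ∫ s in (0 : ℝ)..y, u s := by
  rw [edgeBox, L2.inner_indicatorConstLp_one, edgeMeasure_restrict_Ioc,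
    intervalIntegral.integral_of_le hy]

theorem inner_edgeHat (y : ℝ) (hy : 0 ≤ y) (u : EdgeL2) :
    inner ℂ (edgeHat y) u = ∫ s in (0 : ℝ)..y, ((y - s : ℝ) : ℂ) * u s := by
  rw [L2.inner_def, intervalIntegral.integral_of_le hy, ← edgeMeasure_restrict_Ioc,
    ← integral_indicator measurableSet_Ioc]
  refine integral_congr_ae ?_
  filter_upwards [(memLp_edgeHat y).coeFn_toLp] with s hs
  rw [edgeHat, hs]
  by_cases h : s ∈ Ioc 0 y
  · rw [indicator_of_mem h, indicator_of_mem h, RCLike.inner_apply, Complex.conj_ofReal, mul_comm]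
  · rw [indicator_of_notMem h, indicator_of_notMem h, inner_zero_left]

/-- Integration by parts against $y-x$, which vanishes at the upper end and leaves only the boundary
term at $0$. -/
theorem integral_primitive {p : ℝ → ℂ} {y : ℝ} (hp : IntervalIntegrable p volume 0 y) (a : ℂ) :
    ∫ x in (0 : ℝ)..y, (a + ∫ s in (0 : ℝ)..x, p s)
      = a * y + ∫ s in (0 : ℝ)..y, ((y - s : ℝ) : ℂ) * p s := by
  have h := integral_primitive_mul_primitive (a := a) (c := (y : ℂ)) hp
    (intervalIntegrable_const (c := (-1 : ℂ)))
  have hc : ∀ x : ℝ, (y : ℂ) + ∫ _ in (0 : ℝ)..x, (-1 : ℂ) = ((y - x : ℝ) : ℂ) := fun x => by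
    simp [sub_eq_add_neg]
  simp only [hc, sub_self, Complex.ofReal_zero, mul_zero, mul_neg, mul_one, zero_sub] at h
  have hP : ContinuousOn (fun x => a + ∫ s in (0 : ℝ)..x, p s) (uIcc 0 y) :=
    continuousOn_const.add (absolutelyContinuousOnInterval_primitive hp).continuousOn
  rw [intervalIntegral.integral_add (hp.mul_continuousOn (by fun_prop))
    (g := fun x => -(a + ∫ s in (0 : ℝ)..x, p s)) hP.intervalIntegrable.neg,
    intervalIntegral.integral_neg] at h
  simp only [mul_comm _ (p _)]
  linear_combination -h

/-- The boundary value `u(0)`, tested against the hat function of width `y`. -/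
noncomputable def edgeTrace (y : ℝ) (u p : EdgeL2) : ℂ :=
  inner ℂ (edgeBox y) u - inner ℂ (edgeHat y) p

/-- Integrating over $(0,y)$ trades the almost everywhere identity for equations between inner
products with fixed vectors. These are continuous in $(u,p)$, which is what closedness of the graph
needs; Lebesgue differentiation recovers the pointwise statement. -/
theorem hasEdgeDeriv_iff {u p : EdgeL2} {a : ℂ} :
    HasEdgeDeriv u p a ↔ ∀ y, 0 < y → edgeTrace y u p = a * y := by
  have hP : ∀ y : ℝ, 0 < y →
      IntervalIntegrable (fun x => a + ∫ s in (0 : ℝ)..x, p s) volume 0 y := fun y hy =>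
    (continuousOn_const.add (absolutelyContinuousOnInterval_primitive
      (p.intervalIntegrable hy)).continuousOn).intervalIntegrable
  have key : ∀ y : ℝ, 0 < y → (edgeTrace y u p = a * y ↔
      ∫ s in (0 : ℝ)..y, (u s - (a + ∫ r in (0 : ℝ)..s, p r)) = 0) := fun y hy => by
    rw [edgeTrace, inner_edgeBox y hy.le, inner_edgeHat y hy.le, sub_eq_iff_eq_add,
      ← integral_primitive (p.intervalIntegrable hy), intervalIntegral.integral_sub
      (u.intervalIntegrable hy) (hP y hy), sub_eq_zero]
  constructor
  · intro h y hy
    rw [key y hy, intervalIntegral.integral_of_le hy.le, ← edgeMeasure_restrict_Ioc]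
    refine integral_eq_zero_of_ae (ae_restrict_of_ae ?_)
    filter_upwards [h] with s hs
    simp [hs]
  · intro h
    have := ae_eq_zero_of_primitive_const
      (fun R hR => (u.intervalIntegrable hR).sub (hP R hR)) (fun y hy => (key y hy).1 (h y hy))
    filter_upwards [this] with s hs using sub_eq_zero.1 hs

theorem eq_zero_of_hasEdgeDeriv_zero {p : EdgeL2} {a : ℂ} (h : HasEdgeDeriv 0 p a) : p = 0 := by
  have h1 : ∀ᵐ x ∂edgeMeasure, a + ∫ y in (0 : ℝ)..x, p y = 0 := by
    filter_upwards [h, Lp.coeFn_zero ℂ 2 edgeMeasure] with x hx h0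
    rw [← hx, h0]; rfl
  have hc : ContinuousOn (fun x => a + ∫ y in (0 : ℝ)..x, p y) (Ioi 0) := fun x hx => by
    have h2 := (absolutelyContinuousOnInterval_primitive
      (p.intervalIntegrable (show (0 : ℝ) < x + 1 by linarith [mem_Ioi.1 hx]))).continuousOn
    rw [uIcc_of_le (by linarith [mem_Ioi.1 hx])] at h2
    exact (continuousAt_const.add (h2.continuousAt
      (Icc_mem_nhds hx (by linarith)))).continuousWithinAt
  have h3 := Measure.eqOn_open_of_ae_eq (g := fun _ => (0 : ℂ)) h1 isOpen_Ioi hc continuousOn_const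
  refine (Lp.eq_zero_iff_ae_eq_zero).2 (ae_eq_zero_of_primitive_const (c := -a)
    (fun R hR => p.intervalIntegrable hR) fun x hx => ?_)
  linear_combination h3 hx

theorem hasEdgeDeriv_edgeHat {y : ℝ} (hy : 0 < y) : HasEdgeDeriv (edgeHat y) (-edgeBox y) y := by
  rw [HasEdgeDeriv, ae_restrict_iff' measurableSet_Ioi]
  have h1 := (ae_restrict_iff' measurableSet_Ioi).1 (memLp_edgeHat y).coeFn_toLp
  filter_upwards [h1] with x hx hx0
  have hx0' : 0 < x := hx0
  rw [edgeHat, hx hx0, ← inner_edgeBox x hx0'.le, inner_neg_right, edgeBox, edgeBox,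
    L2.inner_indicatorConstLp_one_indicatorConstLp_one
      (hμs := edgeMeasure_Ioc_ne_top x) (hμt := edgeMeasure_Ioc_ne_top y), Ioc_inter_Ioc, max_self]
  rw [Measure.real, Measure.restrict_apply measurableSet_Ioc,
    inter_eq_left.2 Ioc_subset_Ioi_self, Real.volume_Ioc, sub_zero,
    ENNReal.toReal_ofReal (le_min hx0'.le hy.le)]
  by_cases h : x ≤ y
  · rw [indicator_of_mem (show x ∈ Ioc 0 y from ⟨hx0, h⟩), min_eq_left h]
    simp [sub_eq_add_neg]
  · rw [indicator_of_notMem (show x ∉ Ioc 0 y from fun h' => h h'.2), min_eq_right (le_of_not_ge h)]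
    simp

/-- Integration by parts on the half-line. There is no boundary term at infinity: $\bar u v$ is
integrable and its continuous representative has a limit, which must be $0$. -/
theorem inner_add_inner_of_hasEdgeDeriv {u p v q : EdgeL2} {a c : ℂ} (hu : HasEdgeDeriv u p a)
    (hv : HasEdgeDeriv v q c) :
    inner ℂ u q + inner ℂ p v = -(starRingEnd ℂ a * c) := by
  set P : ℝ → ℂ := fun x => starRingEnd ℂ a + ∫ s in (0 : ℝ)..x, starRingEnd ℂ (p s) with hP
  set Q : ℝ → ℂ := fun x => c + ∫ s in (0 : ℝ)..x, q s with hQ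
  have hPu : ∀ᵐ x ∂edgeMeasure, starRingEnd ℂ (u x) = P x := by
    filter_upwards [hu] with x hx
    rw [hx, map_add, hP]
    simp only [intervalIntegral.intervalIntegral_eq_integral_uIoc, integral_conj, Complex.real_smul,
      map_mul, Complex.conj_ofReal]
  have hg : (fun x => starRingEnd ℂ (p x) * Q x + P x * q x) =ᵐ[edgeMeasure]
      fun x => inner ℂ (p x) (v x) + inner ℂ (u x) (q x) := by
    filter_upwards [hPu, hv] with x h1 h2
    rw [← h1, RCLike.inner_apply, RCLike.inner_apply, h2]
    ring
  have hgint : Integrable (fun x => starRingEnd ℂ (p x) * Q x + P x * q x) edgeMeasure :=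
    ((L2.integrable_inner p v).add (L2.integrable_inner u q)).congr hg.symm
  have hPQint : Integrable (fun x => P x * Q x) edgeMeasure := by
    refine (L2.integrable_inner (𝕜 := ℂ) u v).congr ?_
    filter_upwards [hPu, hv] with x h1 h2
    rw [← h1, RCLike.inner_apply, h2, mul_comm]
  have hconj : ∀ R : ℝ, 0 < R → IntervalIntegrable (fun s => starRingEnd ℂ (p s)) volume 0 R :=
    fun R hR => by
      have h := p.intervalIntegrable hR
      rw [intervalIntegrable_iff] at h ⊢
      exact (LinearIsometryEquiv.integrable_comp_iff Complex.conjLIE).2 h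
  have hlim := intervalIntegral_tendsto_integral_Ioi 0 hgint tendsto_id
  set ℓ := ∫ x in Ioi (0 : ℝ), (starRingEnd ℂ (p x) * Q x + P x * q x) with hℓ
  have hlim2 : Tendsto (fun R => P R * Q R) atTop (𝓝 (ℓ + starRingEnd ℂ a * c)) := by
    refine (hlim.add_const (starRingEnd ℂ a * c)).congr' ?_
    filter_upwards [eventually_gt_atTop 0] with R hR
    rw [id, integral_primitive_mul_primitive (hconj R hR) (q.intervalIntegrable hR)]
    ring
  have hzero : ℓ + starRingEnd ℂ a * c = 0 := by
    refine IntegrableAtFilter.eq_zero_of_tendsto (μ := volume)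
      ⟨Ioi 0, Ioi_mem_atTop _, hPQint⟩ (fun s hs => ?_) hlim2
    obtain ⟨b, hb⟩ := mem_atTop_sets.1 hs
    rw [← top_le_iff, ← Real.volume_Ici (a := b)]
    exact measure_mono hb
  have h1 : ℓ = inner ℂ p v + inner ℂ u q := by
    rw [hℓ, L2.inner_def, L2.inner_def, ← integral_add (L2.integrable_inner p v)
      (L2.integrable_inner u q)]
    exact integral_congr_ae hg
  rw [add_comm, ← h1]
  exact eq_neg_of_add_eq_zero_left hzero

end Edge

/-! ### Von Neumann's theorem on $T^*T$ -/

section VonNeumann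

variable {X : Type*} [NormedAddCommGroup X] [InnerProductSpace ℂ X]

/-- The operator `T* T`, for the operator `T` with graph `G`. -/
def AdjointMulSelf (G : Submodule ℂ (X × X)) (u v : X) : Prop :=
  ∃ p, (u, p) ∈ G ∧ ∀ w q, (w, q) ∈ G → inner ℂ q p = inner ℂ w v

/-- The graph of `c T`, as a subspace of a Hilbert space. -/
def scaledGraph (G : Submodule ℂ (X × X)) (c : ℂ) : Submodule ℂ (WithLp 2 (X × X)) where
  carrier := {z | ∃ p, (z.fst, p) ∈ G ∧ z.snd = c • p}
  zero_mem' := ⟨0, G.zero_mem, by simp⟩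
  add_mem' := by
    rintro z w ⟨p, hp, hz⟩ ⟨q, hq, hw⟩
    exact ⟨p + q, G.add_mem hp hq, by simp [hz, hw]⟩
  smul_mem' := by
    rintro a z ⟨p, hp, hz⟩
    exact ⟨a • p, G.smul_mem a hp, by simp [hz, smul_comm a c]⟩

theorem isClosed_scaledGraph {G : Submodule ℂ (X × X)} (hG : IsClosed (G : Set (X × X))) {c : ℂ}
    (hc : c ≠ 0) : IsClosed (scaledGraph G c : Set (WithLp 2 (X × X))) := by
  have h : (scaledGraph G c : Set (WithLp 2 (X × X))) =
      (fun z : WithLp 2 (X × X) => (z.fst, c⁻¹ • z.snd)) ⁻¹' G := by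
    ext z
    constructor
    · rintro ⟨p, hp, hz⟩
      simpa [hz, smul_smul, inv_mul_cancel₀ hc] using hp
    · intro hz
      exact ⟨_, hz, by simp [smul_smul, mul_inv_cancel₀ hc]⟩
  rw [h]
  exact hG.preimage (by fun_prop)

/-- The embedding of the first factor. -/
noncomputable def inlL2 : X →L[ℂ] WithLp 2 (X × X) :=
  (WithLp.prodContinuousLinearEquiv 2 ℂ X X).symm.toContinuousLinearMap.comp
    (ContinuousLinearMap.inl ℂ X X)

variable [CompleteSpace X]

/-- Von Neumann's theorem: `1 + c T* T` has a contractive self-adjoint inverse. -/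
theorem exists_resolvent_adjointMulSelf {G : Submodule ℂ (X × X)}
    (hG : IsClosed (G : Set (X × X))) {c : ℝ} (hc : 0 < c) :
    ∃ S : X →L[ℂ] X, IsSelfAdjoint S ∧ (∀ x, ‖S x‖ ≤ ‖x‖) ∧
      ∀ u v, AdjointMulSelf G u v ↔ S (u + (c : ℂ) • v) = u := by
  set r : ℂ := ((Real.sqrt c : ℝ) : ℂ) with hr
  have hr0 : r ≠ 0 := by
    rw [hr, Complex.ofReal_ne_zero]; exact (Real.sqrt_pos.2 hc).ne'
  have hrr : r * r = c := by
    rw [hr, ← Complex.ofReal_mul, Real.mul_self_sqrt hc.le]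
  have hrc : starRingEnd ℂ r = r := Complex.conj_ofReal _
  set K := scaledGraph G r with hK
  have : CompleteSpace K := (isClosed_scaledGraph hG hr0).completeSpace_coe
  let P : WithLp 2 (X × X) →L[ℂ] WithLp 2 (X × X) := K.starProjection
  -- Project $(f,0)$ orthogonally onto the graph of $\sqrt c\,T$. If the projection is $(u,\sqrt
  -- c\,p)$, then orthogonality of $(f-u,-\sqrt c\,p)$ to the graph says exactly that
  -- $f-u=c\,T^*Tu$.
  let S : X →L[ℂ] X := (WithLp.fstL 2 ℂ X X).comp (P.comp inlL2)
  have hS : ∀ x, S x = (P (WithLp.toLp 2 (x, 0))).fst := fun x => rfl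
  refine ⟨S, ?_, ?_, ?_⟩
  · refine ContinuousLinearMap.isSelfAdjoint_iff_isSymmetric.2 fun x y => ?_
    have h := K.starProjection_isSymmetric (WithLp.toLp 2 (x, (0 : X))) (WithLp.toLp 2 (y, (0 : X)))
    simp only [WithLp.prod_inner_apply, inner_zero_left, inner_zero_right, add_zero] at h
    exact h
  · intro x
    rw [hS]
    refine (WithLp.norm_fst_le _ _).trans ?_
    refine (K.norm_starProjection_apply_le _).trans_eq ?_
    simp
  · have horth : ∀ (z : WithLp 2 (X × X)), z ∈ Kᗮ ↔
        ∀ w q, (w, q) ∈ G → inner ℂ w z.fst + r * inner ℂ q z.snd = 0 := by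
      intro z
      rw [Submodule.mem_orthogonal]
      constructor
      · intro h w q hwq
        have := h (WithLp.toLp 2 (w, r • q)) ⟨q, hwq, rfl⟩
        simpa [WithLp.prod_inner_apply, inner_smul_left, hrc] using this
      · rintro h y ⟨q, hq, hy⟩
        rw [WithLp.prod_inner_apply]
        change inner ℂ y.fst z.fst + inner ℂ y.snd z.snd = 0
        rw [hy, inner_smul_left, hrc]
        exact h _ _ hq
    intro u v
    constructor
    · rintro ⟨p, hp, h⟩
      have h1 : P (WithLp.toLp 2 (u + (c : ℂ) • v, (0 : X))) = WithLp.toLp 2 (u, r • p) := by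
        refine (Submodule.eq_starProjection_of_mem_orthogonal (K := K) ⟨p, hp, rfl⟩ ?_)
        rw [horth]
        intro w q hwq
        have := h w q hwq
        simp [inner_smul_right, this, ← hrr]
        ring
      rw [hS, h1]
      rfl
    · intro h
      set f := u + (c : ℂ) • v with hf
      obtain ⟨p, hp, hz⟩ : P (WithLp.toLp 2 (f, (0 : X))) ∈ K := K.starProjection_apply_mem _
      have hfst : (P (WithLp.toLp 2 (f, (0 : X)))).fst = u := h
      have h2 := (horth _).1 (K.sub_starProjection_mem_orthogonal (WithLp.toLp 2 (f, (0 : X))))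
      rw [hfst] at hp
      refine ⟨p, hp, fun w q hwq => ?_⟩
      have h3 := h2 w q hwq
      change inner ℂ w (f - (P (WithLp.toLp 2 (f, (0 : X)))).fst)
        + r * inner ℂ q (0 - (P (WithLp.toLp 2 (f, (0 : X)))).snd) = 0 at h3
      rw [hfst, hz, hf, add_sub_cancel_left, zero_sub, inner_neg_right, inner_smul_right,
        inner_smul_right, mul_neg, ← mul_assoc, hrr, ← sub_eq_add_neg, ← mul_sub] at h3
      have hc0 : (c : ℂ) ≠ 0 := by exact_mod_cast hc.ne'
      exact (sub_eq_zero.1 ((mul_eq_zero.1 h3).resolve_left hc0)).symm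

/-- The unitary group generated by `i J T* T`. -/
theorem exists_group_adjointMulSelf {G : Submodule ℂ (X × X)} (hG : IsClosed (G : Set (X × X)))
    {J : X →L[ℂ] X} (hJ : IsSelfAdjoint J) (hJJ : ∀ x, J (J x) = x)
    (hJG : ∀ u p, (u, p) ∈ G → (J u, J p) ∈ G) (h0 : ∀ v, AdjointMulSelf G 0 v → v = 0) :
    ∃ U : ℝ → X →L[ℂ] X, IsGroupGeneratedBy (fun u v => AdjointMulSelf G u (J v)) U ∧
      ∀ t x, ‖U t x‖ = ‖x‖ := by
  have hpos : ∀ n : ℕ, (0 : ℝ) < 1 / (n + 1) := fun n => Nat.one_div_pos_of_nat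
  choose S hSsa hS1 hS using fun n : ℕ => exists_resolvent_adjointMulSelf hG (hpos n)
  have hJsymm : ∀ x y, inner ℂ (J x) y = inner ℂ x (J y) :=
    ContinuousLinearMap.isSelfAdjoint_iff_isSymmetric.1 hJ
  have hJL : ∀ u v, AdjointMulSelf G u v → AdjointMulSelf G (J u) (J v) := by
    rintro u v ⟨p, hp, h⟩
    refine ⟨J p, hJG _ _ hp, fun w q hwq => ?_⟩
    rw [← hJsymm, ← hJsymm]
    exact h _ _ (hJG _ _ hwq)
  refine exists_group_of_resolvent (S := S) (fun n u v => ?_) hSsa hS1 h0 hJ hJJ fun n => ?_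
  · have := hS n u v
    push_cast at this
    exact this
  · ext f
    have hc : ((1 / ((n : ℝ) + 1) : ℝ) : ℂ) ≠ 0 := by exact_mod_cast (hpos n).ne'
    set c : ℂ := ((1 / ((n : ℝ) + 1) : ℝ) : ℂ)
    -- Applying $J$ to this relation shows that $JS_nf$ solves $(1+cT^*T)x=Jf$, whose only solution
    -- is $S_nJf$.
    have h1 : AdjointMulSelf G (S n f) (c⁻¹ • (f - S n f)) := by
      rw [hS n, smul_smul, mul_inv_cancel₀ hc, one_smul, add_sub_cancel]
    have h2 := (hS n _ _).1 (hJL _ _ h1)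
    rw [map_smul, smul_smul, mul_inv_cancel₀ hc, one_smul, map_sub, add_sub_cancel] at h2
    exact h2.symm

end VonNeumann

/-! ### The Kirchhoff Laplacian as $T^*T$ and the free group -/

section Graph

theorem edgeTrace_add (y : ℝ) (u u' p p' : EdgeL2) :
    edgeTrace y (u + u') (p + p') = edgeTrace y u p + edgeTrace y u' p' := by
  simp only [edgeTrace, inner_add_right]; ring

theorem edgeTrace_smul (y : ℝ) (c : ℂ) (u p : EdgeL2) :
    edgeTrace y (c • u) (c • p) = c * edgeTrace y u p := by
  simp only [edgeTrace, inner_smul_right]; ring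

theorem HasEdgeDeriv.add {u u' p p' : EdgeL2} {a a' : ℂ} (h : HasEdgeDeriv u p a)
    (h' : HasEdgeDeriv u' p' a') : HasEdgeDeriv (u + u') (p + p') (a + a') := by
  rw [hasEdgeDeriv_iff] at *
  intro y hy
  rw [edgeTrace_add, h y hy, h' y hy, add_mul]

theorem HasEdgeDeriv.smul {u p : EdgeL2} {a : ℂ} (c : ℂ) (h : HasEdgeDeriv u p a) :
    HasEdgeDeriv (c • u) (c • p) (c * a) := by
  rw [hasEdgeDeriv_iff] at *
  intro y hy
  rw [edgeTrace_smul, h y hy, mul_assoc]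

theorem hasEdgeDeriv_zero : HasEdgeDeriv 0 0 0 := by
  rw [hasEdgeDeriv_iff]
  intro y _
  simp [edgeTrace]

variable {N : ℕ}

/-- The graph of the first derivative on `H¹(Γ)`. -/
def gradGraph (N : ℕ) : Submodule ℂ (GraphL2 N × GraphL2 N) where
  carrier := {z | ∃ a : Fin 2 → ℂ, ∀ j k, HasEdgeDeriv (z.1 (j, k)) (z.2 (j, k)) (a k)}
  zero_mem' := ⟨0, fun _ _ => hasEdgeDeriv_zero⟩
  add_mem' := by
    rintro z w ⟨a, ha⟩ ⟨b, hb⟩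
    exact ⟨a + b, fun j k => (ha j k).add (hb j k)⟩
  smul_mem' := by
    rintro c z ⟨a, ha⟩
    exact ⟨fun k => c * a k, fun j k => (ha j k).smul c⟩

/-- The unknown vertex value is eliminated: on any edge $j'$ it is the trace tested with $y=1$. What
remains is a family of equations between continuous functionals. -/
theorem isClosed_gradGraph : IsClosed (gradGraph N : Set (GraphL2 N × GraphL2 N)) := by
  have h : (gradGraph N : Set (GraphL2 N × GraphL2 N)) =
      ⋂ (j : Fin N) (j' : Fin N) (k : Fin 2) (y : ℝ) (_ : 0 < y),
        {z | edgeTrace y (z.1 (j, k)) (z.2 (j, k)) = edgeTrace 1 (z.1 (j', k)) (z.2 (j', k)) * y} := by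
    ext z
    simp only [mem_iInter, mem_ofPred_eq]
    constructor
    · rintro ⟨a, ha⟩ j j' k y hy
      rw [hasEdgeDeriv_iff.1 (ha j k) y hy, hasEdgeDeriv_iff.1 (ha j' k) 1 one_pos]
      simp
    · intro hz
      rcases isEmpty_or_nonempty (Fin N) with hN | ⟨⟨j'⟩⟩
      · exact ⟨0, fun j => hN.elim j⟩
      · exact ⟨fun k => edgeTrace 1 (z.1 (j', k)) (z.2 (j', k)), fun j k =>
          hasEdgeDeriv_iff.2 fun y hy => hz j j' k y hy⟩
  rw [h]
  refine isClosed_iInter fun j => isClosed_iInter fun j' => isClosed_iInter fun k =>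
    isClosed_iInter fun y => isClosed_iInter fun _ => isClosed_eq ?_ ?_
  · unfold edgeTrace; fun_prop
  · unfold edgeTrace; fun_prop

/-- In one direction, the boundary terms from integration by parts are a common vertex value times
$\sum_jb_{j,k}=0$. In the other, hat functions test both the regularity of $p$ and the Kirchhoff
condition. -/
theorem isGraphLaplacian_iff {u d : GraphL2 N} :
    IsGraphLaplacian u d ↔ AdjointMulSelf (gradGraph N) u (-d) := by
  constructor
  · rintro ⟨p, a, b, hu, hp, hb⟩
    refine ⟨p, ⟨a, hu⟩, ?_⟩
    rintro w q ⟨c, hw⟩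
    have h1 : ∀ j k, inner ℂ (q (j, k)) (p (j, k)) + inner ℂ (w (j, k)) (d (j, k))
        = -(starRingEnd ℂ (c k) * b j k) := fun j k => by
      rw [add_comm]
      exact inner_add_inner_of_hasEdgeDeriv (hw j k) (hp j k)
    have h2 : inner ℂ q p + inner ℂ w d = 0 := by
      rw [PiLp.inner_apply, PiLp.inner_apply, ← Finset.sum_add_distrib, Fintype.sum_prod_type,
        Finset.sum_comm]
      refine Finset.sum_eq_zero fun k _ => ?_
      simp only [h1, Finset.sum_neg_distrib, ← Finset.mul_sum, hb k, mul_zero, neg_zero]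
    rw [inner_neg_right]
    exact eq_neg_of_add_eq_zero_left h2
  · rintro ⟨p, ⟨a, hu⟩, h⟩
    let b : Fin N → Fin 2 → ℂ := fun j k => edgeTrace 1 (p (j, k)) (d (j, k))
    refine ⟨p, a, b, hu, fun j k => hasEdgeDeriv_iff.2 fun y hy => ?_, fun k => ?_⟩
    · let w : GraphL2 N := WithLp.toLp 2 fun i =>
        if i = (j, k) then edgeHat y + (-(y : ℂ)) • edgeHat 1 else 0
      let q : GraphL2 N := WithLp.toLp 2 fun i =>
        if i = (j, k) then -edgeBox y + (-(y : ℂ)) • -edgeBox 1 else 0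
      have hwq : (w, q) ∈ gradGraph N := by
        refine ⟨0, fun j' k' => ?_⟩
        by_cases hi : (j', k') = (j, k)
        · have := (hasEdgeDeriv_edgeHat hy).add ((hasEdgeDeriv_edgeHat one_pos).smul (-(y : ℂ)))
          simpa [w, q, hi] using this
        · simpa [w, q, hi] using hasEdgeDeriv_zero
      have h1 := h w q hwq
      have hw : ∀ v : GraphL2 N, inner ℂ w v
          = inner ℂ (edgeHat y + (-(y : ℂ)) • edgeHat 1) (v (j, k)) := fun v => by
        rw [PiLp.inner_apply, Finset.sum_eq_single (j, k)]
        · simp [w]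
        · intro i _ hi; simp [w, hi]
        · simp
      have hq : ∀ v : GraphL2 N, inner ℂ q v
          = inner ℂ (-edgeBox y + (-(y : ℂ)) • -edgeBox 1) (v (j, k)) := fun v => by
        rw [PiLp.inner_apply, Finset.sum_eq_single (j, k)]
        · simp [q]
        · intro i _ hi; simp [q, hi]
        · simp
      rw [hw, hq] at h1
      simp only [PiLp.neg_apply, inner_add_left, inner_smul_left, inner_neg_left, inner_neg_right,
        map_neg, Complex.conj_ofReal] at h1
      simp only [b, edgeTrace]
      linear_combination -h1
    -- The same hat on every edge is continuous at the vertex with value $1$, so it detects the sum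
    -- of the boundary derivatives.
    · let w : GraphL2 N := WithLp.toLp 2 fun i => if i.2 = k then edgeHat 1 else 0
      let q : GraphL2 N := WithLp.toLp 2 fun i => if i.2 = k then -edgeBox 1 else 0
      have hwq : (w, q) ∈ gradGraph N := by
        refine ⟨fun k' => if k' = k then ((1 : ℝ) : ℂ) else 0, fun j' k' => ?_⟩
        by_cases hi : k' = k
        · simpa [w, q, hi] using hasEdgeDeriv_edgeHat one_pos
        · simpa [w, q, hi] using hasEdgeDeriv_zero
      have h1 := h w q hwq
      have hsum : ∀ (x : EdgeL2) (v : GraphL2 N),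
          inner ℂ (WithLp.toLp 2 fun i : Fin N × Fin 2 => if i.2 = k then x else 0 : GraphL2 N) v
            = ∑ j, inner ℂ x (v (j, k)) := fun x v => by
        rw [PiLp.inner_apply, Fintype.sum_prod_type]
        refine Finset.sum_congr rfl fun j _ => ?_
        rw [Finset.sum_eq_single k]
        · simp
        · intro i _ hi; simp [hi]
        · simp
      rw [hsum, hsum] at h1
      simp only [PiLp.neg_apply, inner_neg_left, inner_neg_right, Finset.sum_neg_distrib] at h1
      simp only [b, edgeTrace, Finset.sum_sub_distrib]
      linear_combination -h1

theorem eq_zero_of_isGraphLaplacian_zero {d : GraphL2 N} (h : IsGraphLaplacian 0 d) : d = 0 := by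
  obtain ⟨p, a, b, hu, hp, -⟩ := h
  ext1 ⟨j, k⟩
  have h1 : p (j, k) = 0 := eq_zero_of_hasEdgeDeriv_zero (hu j k)
  have h2 := hp j k
  rw [h1] at h2
  exact eq_zero_of_hasEdgeDeriv_zero h2

/-- Multiplication of the components `u (j, k)` by a scalar `c k`. -/
noncomputable def compSmul (N : ℕ) (c : Fin 2 → ℂ) : GraphL2 N →L[ℂ] GraphL2 N :=
  (PiLp.continuousLinearEquiv 2 ℂ fun _ : Fin N × Fin 2 => EdgeL2).symm.toContinuousLinearMap.comp
    (ContinuousLinearMap.pi fun i => c i.2 • PiLp.proj 2 (fun _ : Fin N × Fin 2 => EdgeL2) i)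

theorem compSmul_apply (c : Fin 2 → ℂ) (u : GraphL2 N) (i : Fin N × Fin 2) :
    compSmul N c u i = c i.2 • u i := rfl

theorem compSmul_compSmul (c c' : Fin 2 → ℂ) (u : GraphL2 N) :
    compSmul N c (compSmul N c' u) = compSmul N (fun k => c k * c' k) u := by
  ext1 i
  simp only [compSmul_apply, smul_smul]

theorem compSmul_one (u : GraphL2 N) : compSmul N (fun _ => 1) u = u := by
  ext1 i
  simp only [compSmul_apply, one_smul]

theorem isSelfAdjoint_compSmul {c : Fin 2 → ℂ} (hc : ∀ k, starRingEnd ℂ (c k) = c k) :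
    IsSelfAdjoint (compSmul N c) := by
  refine ContinuousLinearMap.isSelfAdjoint_iff_isSymmetric.2 fun u v => ?_
  change inner ℂ (compSmul N c u) v = inner ℂ u (compSmul N c v)
  simp only [PiLp.inner_apply, compSmul_apply, inner_smul_left, inner_smul_right, hc]

theorem IsGraphLaplacian.compSmul {u d : GraphL2 N} (c : Fin 2 → ℂ) (h : IsGraphLaplacian u d) :
    IsGraphLaplacian (compSmul N c u) (compSmul N c d) := by
  obtain ⟨p, a, b, hu, hp, hb⟩ := h
  refine ⟨_root_.compSmul N c p, fun k => c k * a k, fun j k => c k * b j k,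
    fun j k => (hu j k).smul (c k), fun j k => (hp j k).smul (c k), fun k => ?_⟩
  rw [← Finset.mul_sum, hb k, mul_zero]

/-- The matrix `θ₃ = diag(1, -1)`. -/
noncomputable def theta3 (N : ℕ) : GraphL2 N →L[ℂ] GraphL2 N := compSmul N ![1, -1]

theorem theta3_theta3 (u : GraphL2 N) : theta3 N (theta3 N u) = u := by
  rw [theta3, compSmul_compSmul]
  have h : (fun k : Fin 2 => (![1, -1] k * ![1, -1] k : ℂ)) = fun _ => 1 := by
    funext k
    fin_cases k <;> simp
  rw [h, compSmul_one]

theorem freeOp_iff {u v : GraphL2 N} : FreeOp N u v ↔ IsGraphLaplacian u (-theta3 N v) := by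
  have h : ∀ d : GraphL2 N, (∀ j, v (j, 0) = -d (j, 0) ∧ v (j, 1) = d (j, 1)) ↔
      d = -theta3 N v := by
    intro d
    constructor
    · intro h
      ext1 ⟨j, k⟩
      obtain ⟨h0, h1⟩ := h j
      fin_cases k
      · simp [theta3, compSmul_apply, h0]
      · simp [theta3, compSmul_apply, h1]
    · rintro rfl j
      simp [theta3, compSmul_apply]
  simp only [FreeOp, h]
  exact exists_eq_right

/-- The free group `e^{itJ₀}` exists and is unitary. -/
theorem exists_freeGroup (N : ℕ) : ∃ U : ℝ → GraphL2 N →L[ℂ] GraphL2 N,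
    IsGroupGeneratedBy (FreeOp N) U ∧ ∀ t u, ‖U t u‖ = ‖u‖ := by
  have h := exists_group_adjointMulSelf (G := gradGraph N) isClosed_gradGraph (J := theta3 N)
    (isSelfAdjoint_compSmul fun k => by fin_cases k <;> simp) theta3_theta3 ?_ ?_
  · have e : (fun u v => AdjointMulSelf (gradGraph N) u (theta3 N v)) = FreeOp N := by
      funext u v
      rw [eq_iff_iff, freeOp_iff, isGraphLaplacian_iff, neg_neg]
    rwa [e] at h
  · rintro u p ⟨a, ha⟩
    exact ⟨fun k => ![1, -1] k * a k, fun j k => (ha j k).smul _⟩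
  · intro v hv
    rw [← neg_neg v, ← isGraphLaplacian_iff] at hv
    exact neg_eq_zero.1 (eq_zero_of_isGraphLaplacian_zero hv)

end Graph

/-! ### Phase rotations and the group of $J_0+w\theta_3$ -/

section Phase

variable {N : ℕ}

/-- The phase rotation as a bounded operator. -/
noncomputable def phaseCLM (N : ℕ) (r : ℝ) : GraphL2 N →L[ℂ] GraphL2 N :=
  compSmul N ![Complex.exp (Complex.I * r), Complex.exp (-(Complex.I * r))]

theorem phaseCLM_apply (r : ℝ) (u : GraphL2 N) : phaseCLM N r u = phaseRot r u := by
  ext1 ⟨j, k⟩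
  fin_cases k <;> simp [phaseCLM, compSmul_apply, phaseRot]

theorem phaseCLM_zero (u : GraphL2 N) : phaseCLM N 0 u = u := by
  ext1 ⟨j, k⟩
  fin_cases k <;> simp [phaseCLM, compSmul_apply]

theorem phaseCLM_add (r s : ℝ) (u : GraphL2 N) :
    phaseCLM N (r + s) u = phaseCLM N r (phaseCLM N s u) := by
  rw [phaseCLM, phaseCLM, phaseCLM, compSmul_compSmul]
  congr 2
  funext k
  fin_cases k
  · simp [← Complex.exp_add, mul_add]
  · simp [← Complex.exp_add, mul_add, add_comm]

theorem norm_phaseCLM_apply (r : ℝ) (u : GraphL2 N) : ‖phaseCLM N r u‖ = ‖u‖ := by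
  have h : ∀ i, ‖phaseCLM N r u i‖ = ‖u i‖ := by
    rintro ⟨j, k⟩
    fin_cases k
    · simp [phaseCLM, compSmul_apply, norm_smul, Complex.norm_exp]
    · simp [phaseCLM, compSmul_apply, norm_smul, Complex.norm_exp]
  rw [PiLp.norm_eq_of_L2, PiLp.norm_eq_of_L2]
  simp only [h]

theorem hasDerivAt_phaseCLM (w : ℝ) (u : GraphL2 N) :
    HasDerivAt (fun t => phaseCLM N (w * t) u) (Complex.I • ((w : ℂ) • theta3 N u)) 0 := by
  let R : Fin 2 → GraphL2 N := fun k => compSmul N (Pi.single k 1) u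
  have he : ∀ c : ℂ, HasDerivAt (fun t : ℝ => Complex.exp (c * t)) c 0 := fun c => by
    have h : HasDerivAt (fun z : ℂ => Complex.exp (c * z)) c ((0 : ℝ) : ℂ) := by
      simpa using ((hasDerivAt_id (0 : ℂ)).const_mul c).cexp
    exact h.comp_ofReal
  have h := ((he (Complex.I * w)).smul_const (R 0)).add ((he (-(Complex.I * w))).smul_const (R 1))
  refine (h.congr_of_eventuallyEq (Eventually.of_forall fun t => ?_)).congr_deriv ?_
  · ext1 ⟨j, k⟩
    fin_cases k <;> simp [R, phaseCLM, compSmul_apply, mul_assoc]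
  · ext1 ⟨j, k⟩
    simp only [R, theta3, PiLp.add_apply, PiLp.smul_apply, compSmul_apply, smul_smul]
    fin_cases k <;> simp

theorem FreeOp.phase {u v : GraphL2 N} (r : ℝ) (h : FreeOp N u v) :
    FreeOp N (phaseCLM N r u) (phaseCLM N r v) := by
  rw [freeOp_iff] at h ⊢
  have h1 := h.compSmul ![Complex.exp (Complex.I * r), Complex.exp (-(Complex.I * r))]
  have h2 : theta3 N (phaseCLM N r v) = phaseCLM N r (theta3 N v) := by
    rw [theta3, phaseCLM, compSmul_compSmul, compSmul_compSmul]
    simp only [mul_comm]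
  rw [h2, ← map_neg]
  exact h1

/-- The group `T_{wt} e^{itJ₀}` is generated by `J₀ + w θ₃`. -/
theorem isGroupGeneratedBy_phase {U : ℝ → GraphL2 N →L[ℂ] GraphL2 N}
    (hU : IsGroupGeneratedBy (FreeOp N) U) (w : ℝ) :
    (∀ t r u, U t (phaseCLM N r u) = phaseCLM N r (U t u)) ∧
    IsGroupGeneratedBy (fun u v => FreeOp N u (v - (w : ℂ) • theta3 N u))
      fun t => (U t).comp (phaseCLM N (w * t)) := by
  have hinv : ∀ r u, phaseCLM N r (phaseCLM N (-r) u) = u := fun r u => by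
    rw [← phaseCLM_add, add_neg_cancel, phaseCLM_zero]
  have hinv' : ∀ r u, phaseCLM N (-r) (phaseCLM N r u) = u := fun r u => by
    rw [← phaseCLM_add, neg_add_cancel, phaseCLM_zero]
  -- Rotations act by one scalar per component, the same on all edges, so they preserve the vertex
  -- conditions and are symmetries of $J_0$.
  have hcomm : ∀ t r u, U t (phaseCLM N r u) = phaseCLM N r (U t u) := fun t r u =>
    hU.commute_of_symm (hinv r) (hinv' r)
      (fun u v => ⟨fun h => by simpa only [hinv'] using h.phase (-r), fun h => h.phase r⟩) t u
  refine ⟨hcomm, ⟨?_, ?_, ?_, ?_⟩⟩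
  · ext1 u
    simp [hU.zero, phaseCLM_zero]
  · intro s t
    ext1 u
    change U (s + t) (phaseCLM N (w * (s + t)) u)
      = U s (phaseCLM N (w * s) (U t (phaseCLM N (w * t) u)))
    rw [← hcomm, ← phaseCLM_add, ← mul_add, hU.add]
    rfl
  · intro u
    refine continuous_iff_continuousAt.2 fun t => ?_
    have h : Continuous fun t => phaseCLM N (w * t) u := by
      have h1 : ∀ c : ℂ, Continuous fun t : ℝ => Complex.exp (c * t) := fun c => by fun_prop
      have h2 := ((h1 (Complex.I * w)).smul (continuous_const (y := compSmul N (Pi.single 0 1) u))).add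
        ((h1 (-(Complex.I * w))).smul (continuous_const (y := compSmul N (Pi.single 1 1) u)))
      refine h2.congr fun t => ?_
      ext1 ⟨j, k⟩
      fin_cases k <;> simp [phaseCLM, compSmul_apply, mul_assoc]
    exact hU.tendsto_apply tendsto_id (h.tendsto t)
  · intro u v
    exact hU.hasDerivAt_comp_iff (by simp [phaseCLM_zero]) (hasDerivAt_phaseCLM w u) v

end Phase

/-! ### The matrix potential and its weighted bound -/

section Potential

theorem exists_mulOp {g : ℝ → ℝ} (hg : Continuous g) {K : ℝ} (hb : ∀ x, |g x| ≤ K) :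
    ∃ M : EdgeL2 →L[ℂ] EdgeL2, ∀ u, ∀ᵐ x ∂edgeMeasure, M u x = (g x : ℂ) * u x := by
  have hbu : ∀ (u : EdgeL2) x, ‖(g x : ℂ) * u x‖ ≤ K * ‖u x‖ := fun u x => by
    rw [norm_mul, Complex.norm_real]
    exact mul_le_mul_of_nonneg_right (hb x) (norm_nonneg _)
  have hm : ∀ u : EdgeL2, MemLp (fun x => (g x : ℂ) * u x) 2 edgeMeasure := fun u =>
    (Lp.memLp u).of_le_mul ((Complex.continuous_ofReal.comp hg).aestronglyMeasurable.mul
      (Lp.aestronglyMeasurable u)) (Eventually.of_forall (hbu u))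
  let M : EdgeL2 →ₗ[ℂ] EdgeL2 :=
    { toFun := fun u => (hm u).toLp _
      map_add' := fun u v => by
        rw [← MemLp.toLp_add]
        refine MemLp.toLp_congr _ _ ?_
        filter_upwards [Lp.coeFn_add u v] with x hx
        change (g x : ℂ) * (u + v : EdgeL2) x = g x * u x + g x * v x
        rw [hx, Pi.add_apply, mul_add]
      map_smul' := fun c u => by
        rw [RingHom.id_apply, ← MemLp.toLp_const_smul]
        refine MemLp.toLp_congr _ _ ?_
        filter_upwards [Lp.coeFn_smul c u] with x hx
        simp [hx, mul_left_comm] }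
  refine ⟨M.mkContinuous K fun u => ?_, fun u => (hm u).coeFn_toLp⟩
  refine Lp.norm_le_mul_norm_of_ae_le_mul ?_
  filter_upwards [(hm u).coeFn_toLp] with x hx
  change ‖(hm u).toLp _ x‖ ≤ _
  rw [hx]
  exact hbu u x

theorem norm_edgeL2_eq (u : EdgeL2) : ‖u‖ = Real.sqrt (∫ x, ‖u x‖ ^ 2 ∂edgeMeasure) := by
  rw [@norm_eq_sqrt_re_inner ℂ, L2.inner_def]
  congr 1
  rw [← integral_re (L2.integrable_inner u u)]
  refine integral_congr_ae (Eventually.of_forall fun x => ?_)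
  exact inner_self_eq_norm_sq (𝕜 := ℂ) (u x)

variable {N : ℕ}

theorem edge_weightedNorm_le (u : GraphL2 N) (i : Fin N × Fin 2) :
    Real.sqrt (∫ x, (rho x ^ 2 * ‖u i x‖) ^ 2 ∂edgeMeasure) ≤ weightedNorm u :=
  Real.sqrt_le_sqrt (Finset.single_le_sum
    (f := fun i => ∫ x, (rho x ^ 2 * ‖u i x‖) ^ 2 ∂edgeMeasure)
    (fun _ _ => integral_nonneg fun _ => sq_nonneg _) (Finset.mem_univ i))

theorem continuous_rho : Continuous rho := by
  unfold rho
  exact (by fun_prop : Continuous fun x : ℝ => 1 + |x|).inv₀ fun x => by positivity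

theorem norm_mulOp_le {g : ℝ → ℝ} {C : ℝ} (hC : ∀ x, |g x| ≤ C * rho x ^ 2)
    {M : EdgeL2 →L[ℂ] EdgeL2} (hM : ∀ u, ∀ᵐ x ∂edgeMeasure, M u x = (g x : ℂ) * u x) (u : EdgeL2) :
    ‖M u‖ ≤ C * Real.sqrt (∫ x, (rho x ^ 2 * ‖u x‖) ^ 2 ∂edgeMeasure) := by
  obtain ⟨R, hR⟩ := exists_mulOp (g := fun x => rho x ^ 2) (K := 1) (continuous_rho.pow 2)
    fun x => by
      rw [abs_of_nonneg (sq_nonneg _)]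
      exact pow_le_one₀ (rho_pos x).le (rho_le_one x)
  have hRn : ∀ᵐ x ∂edgeMeasure, ‖R u x‖ = rho x ^ 2 * ‖u x‖ := by
    filter_upwards [hR u] with x hx
    rw [hx, norm_mul, Complex.norm_real, Real.norm_of_nonneg (sq_nonneg _)]
  have h1 : ‖R u‖ = Real.sqrt (∫ x, (rho x ^ 2 * ‖u x‖) ^ 2 ∂edgeMeasure) := by
    rw [norm_edgeL2_eq]
    congr 1
    refine integral_congr_ae ?_
    filter_upwards [hRn] with x hx
    rw [hx]
  rw [← h1]
  refine Lp.norm_le_mul_norm_of_ae_le_mul ?_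
  filter_upwards [hM u, hRn] with x h2 h3
  rw [h2, h3, norm_mul, Complex.norm_real, ← mul_assoc]
  exact mul_le_mul_of_nonneg_right (hC x) (norm_nonneg _)

/-- The potential `(D, O; -O, -D)` on each edge. -/
noncomputable def potential (D O : Fin N → EdgeL2 →L[ℂ] EdgeL2) : GraphL2 N →L[ℂ] GraphL2 N :=
  (PiLp.continuousLinearEquiv 2 ℂ fun _ : Fin N × Fin 2 => EdgeL2).symm.toContinuousLinearMap.comp
    (ContinuousLinearMap.pi fun i => ![(1 : ℂ), -1] i.2 •
      ((D i.1).comp (PiLp.proj 2 (fun _ : Fin N × Fin 2 => EdgeL2) i)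
        + (O i.1).comp (PiLp.proj 2 (fun _ : Fin N × Fin 2 => EdgeL2) (i.1, 1 - i.2))))

theorem potential_apply (D O : Fin N → EdgeL2 →L[ℂ] EdgeL2) (u : GraphL2 N) (i : Fin N × Fin 2) :
    potential D O u i = ![(1 : ℂ), -1] i.2 • (D i.1 (u i) + O i.1 (u (i.1, 1 - i.2))) := rfl

theorem norm_potential_le {D O : Fin N → EdgeL2 →L[ℂ] EdgeL2} {K : ℝ} (hK : 0 ≤ K)
    (hD : ∀ j u, ‖D j u‖ ≤ K * Real.sqrt (∫ x, (rho x ^ 2 * ‖u x‖) ^ 2 ∂edgeMeasure))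
    (hO : ∀ j u, ‖O j u‖ ≤ K * Real.sqrt (∫ x, (rho x ^ 2 * ‖u x‖) ^ 2 ∂edgeMeasure))
    (u : GraphL2 N) :
    ‖potential D O u‖ ≤ Real.sqrt (Fintype.card (Fin N × Fin 2)) * (2 * K) * weightedNorm u := by
  have h : ∀ i, ‖potential D O u i‖ ≤ 2 * K * weightedNorm u := fun i => by
    have hs : ‖![(1 : ℂ), -1] i.2‖ = 1 := by
      obtain ⟨j, k⟩ := i
      fin_cases k <;> simp
    rw [potential_apply, norm_smul, hs, one_mul]
    have h1 := (hD i.1 (u i)).trans (mul_le_mul_of_nonneg_left (edge_weightedNorm_le u i) hK)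
    have h2 := (hO i.1 (u (i.1, 1 - i.2))).trans
      (mul_le_mul_of_nonneg_left (edge_weightedNorm_le u _) hK)
    have h3 := norm_add_le (D i.1 (u i)) (O i.1 (u (i.1, 1 - i.2)))
    linarith
  have hw : 0 ≤ weightedNorm u := Real.sqrt_nonneg _
  rw [PiLp.norm_eq_of_L2, mul_assoc]
  refine Real.sqrt_le_iff.2 ⟨by positivity, ?_⟩
  refine (Finset.sum_le_sum fun i _ => pow_le_pow_left₀ (norm_nonneg _) (h i) 2).trans_eq ?_
  rw [Finset.sum_const, Finset.card_univ, nsmul_eq_mul, mul_pow (Real.sqrt _), Real.sq_sqrt (Nat.cast_nonneg _)]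

/-- This is $\mathcal H=J_0+w\theta_3+V$. The same Laplacian `d` serves both sides, so only
identities in $L^2$ and almost everywhere have to be matched. -/
theorem linearizedOp_iff {F : ℝ → ℝ} {α : ℝ} {φ : ℝ → ℝ} {b : Fin N → ℝ}
    {D O : Fin N → EdgeL2 →L[ℂ] EdgeL2}
    (hD : ∀ j u, ∀ᵐ x ∂edgeMeasure, D j u x = (diagCoeff F φ (x - b j) : ℂ) * u x)
    (hO : ∀ j u, ∀ᵐ x ∂edgeMeasure, O j u x = (offDiagCoeff F φ (x - b j) : ℂ) * u x)
    (u v : GraphL2 N) :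
    LinearizedOp F α φ b u v ↔
      FreeOp N u (v - potential D O u - ((α ^ 2 / 4 : ℝ) : ℂ) • theta3 N u) := by
  refine exists_congr fun d => and_congr_right fun _ => forall_congr' fun j => and_congr ?_ ?_
  · have h : ∀ᵐ x ∂edgeMeasure, (-d (j, 0) + ((α ^ 2 / 4 : ℝ) : ℂ) • u (j, 0) + D j (u (j, 0))
        + O j (u (j, 1))) x = -d (j, 0) x + ((α ^ 2 / 4 : ℝ) : ℂ) * u (j, 0) x
        + (diagCoeff F φ (x - b j) : ℂ) * u (j, 0) x
        + (offDiagCoeff F φ (x - b j) : ℂ) * u (j, 1) x := by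
      filter_upwards [Lp.coeFn_add (-d (j, 0) + ((α ^ 2 / 4 : ℝ) : ℂ) • u (j, 0) + D j (u (j, 0)))
          (O j (u (j, 1))),
        Lp.coeFn_add (-d (j, 0) + ((α ^ 2 / 4 : ℝ) : ℂ) • u (j, 0)) (D j (u (j, 0))),
        Lp.coeFn_add (-d (j, 0)) (((α ^ 2 / 4 : ℝ) : ℂ) • u (j, 0)), Lp.coeFn_neg (d (j, 0)),
        Lp.coeFn_smul ((α ^ 2 / 4 : ℝ) : ℂ) (u (j, 0)), hD j (u (j, 0)), hO j (u (j, 1))]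
        with x h1 h2 h3 h4 h5 h6 h7
      simp only [h1, h2, h3, h4, h5, h6, h7, Pi.add_apply, Pi.neg_apply, Pi.smul_apply, smul_eq_mul]
    have e : (v - potential D O u - ((α ^ 2 / 4 : ℝ) : ℂ) • theta3 N u) (j, 0) = -d (j, 0) ↔
        v (j, 0) = -d (j, 0) + ((α ^ 2 / 4 : ℝ) : ℂ) • u (j, 0) + D j (u (j, 0))
          + O j (u (j, 1)) := by
      simp only [PiLp.sub_apply, PiLp.smul_apply, potential_apply, theta3, compSmul_apply,
        Matrix.cons_val_zero, one_smul, sub_zero, sub_eq_iff_eq_add]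
      rw [add_assoc _ (D j _), add_assoc]
    rw [e, Lp.ext_iff]
    constructor
    · intro h'
      filter_upwards [h', h] with x h1 h2 using h1.trans h2.symm
    · intro h'
      filter_upwards [h', h] with x h1 h2 using h1.trans h2
  · have h : ∀ᵐ x ∂edgeMeasure, (-(-d (j, 1) + ((α ^ 2 / 4 : ℝ) : ℂ) • u (j, 1)) - D j (u (j, 1))
        - O j (u (j, 0))) x = -(-d (j, 1) x + ((α ^ 2 / 4 : ℝ) : ℂ) * u (j, 1) x)
        - (diagCoeff F φ (x - b j) : ℂ) * u (j, 1) x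
        - (offDiagCoeff F φ (x - b j) : ℂ) * u (j, 0) x := by
      filter_upwards [
        Lp.coeFn_sub (-(-d (j, 1) + ((α ^ 2 / 4 : ℝ) : ℂ) • u (j, 1)) - D j (u (j, 1)))
          (O j (u (j, 0))),
        Lp.coeFn_sub (-(-d (j, 1) + ((α ^ 2 / 4 : ℝ) : ℂ) • u (j, 1))) (D j (u (j, 1))),
        Lp.coeFn_neg (-d (j, 1) + ((α ^ 2 / 4 : ℝ) : ℂ) • u (j, 1)),
        Lp.coeFn_add (-d (j, 1)) (((α ^ 2 / 4 : ℝ) : ℂ) • u (j, 1)), Lp.coeFn_neg (d (j, 1)),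
        Lp.coeFn_smul ((α ^ 2 / 4 : ℝ) : ℂ) (u (j, 1)), hD j (u (j, 1)), hO j (u (j, 0))]
        with x h1 h2 h3 h4 h5 h6 h7 h8
      simp only [h1, h2, h3, h4, h5, h6, h7, h8, Pi.add_apply, Pi.sub_apply, Pi.neg_apply,
        Pi.smul_apply, smul_eq_mul]
    have e : (v - potential D O u - ((α ^ 2 / 4 : ℝ) : ℂ) • theta3 N u) (j, 1) = d (j, 1) ↔
        v (j, 1) = -(-d (j, 1) + ((α ^ 2 / 4 : ℝ) : ℂ) • u (j, 1)) - D j (u (j, 1))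
          - O j (u (j, 0)) := by
      simp only [PiLp.sub_apply, PiLp.smul_apply, potential_apply, theta3, compSmul_apply,
        Matrix.cons_val_one, Matrix.cons_val_zero, neg_smul, one_smul, sub_self,
        sub_eq_iff_eq_add]
      rw [← sub_eq_zero, ← sub_eq_zero (a := v (j, 1))]
      have : ∀ a c : EdgeL2, a = c → (a = 0 ↔ c = 0) := fun a c h => by rw [h]
      apply this
      simp only [smul_neg]
      abel
    rw [e, Lp.ext_iff]
    constructor
    · intro h'
      filter_upwards [h', h] with x h1 h2 using h1.trans h2.symm
    · intro h'
      filter_upwards [h', h] with x h1 h2 using h1.trans h2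

end Potential

/-! ### Cook's method and the conclusion -/

section Scattering

/-- Since $3/2>1$ the derivative is integrable on $(1,\infty)$; the singularity of the bound at $0$
plays no role. -/
theorem exists_limit_of_deriv_decay {E : Type*} [NormedAddCommGroup E] [NormedSpace ℝ E]
    [CompleteSpace E] {Y Y' : ℝ → E} (hY : ∀ t, HasDerivAt Y (Y' t) t) (hc : Continuous Y') {C : ℝ}
    (hb : ∀ t, 0 < t → ‖Y' t‖ ≤ C * t ^ (-(3 / 2) : ℝ)) : ∃ y, Tendsto Y atTop (𝓝 y) := by
  have hint : IntegrableOn (fun t : ℝ => C * t ^ (-(3 / 2) : ℝ)) (Ioi 1) :=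
    (integrableOn_Ioi_rpow_of_lt (by norm_num) one_pos).const_mul C
  refine ⟨_, tendsto_limUnder_of_hasDerivAt_of_integrableOn_Ioi (a := 1) (fun t _ => hY t)
    (hint.mono' hc.aestronglyMeasurable ?_)⟩
  rw [ae_restrict_iff' measurableSet_Ioi]
  exact Eventually.of_forall fun t ht => hb t (one_pos.trans ht)

end Scattering

theorem lemma3p1 (N : ℕ) (F : ℝ → ℝ) (hF : ContDiffOn ℝ ∞ F (Ici 0)) (hF0 : F 0 = 0)
    (α : ℝ) (hα : 0 < α) (φ : ℝ → ℝ) (hφ : IsProfile F α φ) (b : Fin N → ℝ) (f : GraphL2 N) :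
    ((∃ C : ℝ, ∀ t : ℝ, 0 < t →
        weightedNorm (expI (LinearizedOp F α φ b) (-t) f) ≤ C * t ^ (-(3 / 2) : ℝ)) →
      ∃ fplus : GraphL2 N, Tendsto (fun t : ℝ =>
        ‖expI (LinearizedOp F α φ b) (-t) f
          - phaseRot (-(α ^ 2 / 4 * t)) (expI (FreeOp N) (-t) fplus)‖) atTop (𝓝 0)) ∧
    ((∃ C : ℝ, ∀ t : ℝ, 0 < t →
        weightedNorm (expI (LinearizedOp F α φ b) t f) ≤ C * t ^ (-(3 / 2) : ℝ)) →
      ∃ fplus : GraphL2 N, Tendsto (fun t : ℝ =>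
        ‖expI (LinearizedOp F α φ b) t f
          - phaseRot (α ^ 2 / 4 * t) (expI (FreeOp N) t fplus)‖) atTop (𝓝 0)) := by
  obtain ⟨hdc, hoc, C₀, hC₀⟩ := hφ.exists_coeff_bound hF hF0 hα
  have hC₀0 : 0 ≤ C₀ := by
    have h := (abs_nonneg _).trans (hC₀ 0).1
    simpa [rho] using h
  obtain ⟨B, hB⟩ := (Set.finite_range fun j => |b j|).bddAbove
  have hBj : ∀ j, |b j| ≤ B := fun j => hB ⟨j, rfl⟩
  -- Each shift costs a factor $(1+|b_j|)^2$ in the weight $\rho^2$; there are finitely many edges,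
  -- so one constant serves all.
  set K := C₀ * (1 + |B|) ^ 2 with hK
  have hK0 : 0 ≤ K := by positivity
  have hshift : ∀ j x, C₀ * rho (x - b j) ^ 2 ≤ K * rho x ^ 2 := fun j x => by
    rw [hK, mul_assoc, ← mul_pow]
    refine mul_le_mul_of_nonneg_left (pow_le_pow_left₀ (rho_pos _).le ?_ 2) hC₀0
    refine (rho_sub_le x (b j)).trans (mul_le_mul_of_nonneg_right ?_ (rho_pos x).le)
    linarith [hBj j, le_abs_self B]
  have hdb : ∀ j x, |diagCoeff F φ (x - b j)| ≤ K * rho x ^ 2 := fun j x =>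
    (hC₀ _).1.trans (hshift j x)
  have hob : ∀ j x, |offDiagCoeff F φ (x - b j)| ≤ K * rho x ^ 2 := fun j x =>
    (hC₀ _).2.trans (hshift j x)
  have hKρ : ∀ x, K * rho x ^ 2 ≤ K := fun x =>
    mul_le_of_le_one_right hK0 (pow_le_one₀ (rho_pos x).le (rho_le_one x))
  choose D hD using fun j => exists_mulOp (g := fun x => diagCoeff F φ (x - b j))
    (hdc.comp (continuous_sub_right _)) (K := K) fun x => (hdb j x).trans (hKρ x)
  choose O hO using fun j => exists_mulOp (g := fun x => offDiagCoeff F φ (x - b j))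
    (hoc.comp (continuous_sub_right _)) (K := K) fun x => (hob j x).trans (hKρ x)
  obtain ⟨U, hU, hUn⟩ := exists_freeGroup N
  obtain ⟨hcomm, hU₁⟩ := isGroupGeneratedBy_phase hU (α ^ 2 / 4)
  have hU₁n : ∀ t u, ‖((U t).comp (phaseCLM N (α ^ 2 / 4 * t))) u‖ = ‖u‖ := fun t u =>
    (hUn t _).trans (norm_phaseCLM_apply _ u)
  obtain ⟨V, hV, hW⟩ := hU₁.exists_perturbation hU₁n (potential D O)
  have hL : (fun u v => FreeOp N u (v - potential D O u - ((α ^ 2 / 4 : ℝ) : ℂ) • theta3 N u))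
      = LinearizedOp F α φ b := by
    funext u v
    exact propext (linearizedOp_iff hD hO u v).symm
  rw [hL] at hV
  rw [expI_eq hU, expI_eq hV]
  set U₁ : ℝ → GraphL2 N →L[ℂ] GraphL2 N := fun t => (U t).comp (phaseCLM N (α ^ 2 / 4 * t))
  set K' := Real.sqrt (Fintype.card (Fin N × Fin 2)) * (2 * K)
  have hK' : 0 ≤ K' := by positivity
  have hpot : ∀ t, ‖U₁ (-t) (Complex.I • potential D O (V t f))‖ ≤ K' * weightedNorm (V t f) :=
    fun t => by
      rw [hU₁n, norm_smul, Complex.norm_I, one_mul]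
      exact norm_potential_le hK0 (fun j => norm_mulOp_le (hdb j) (hD j))
        (fun j => norm_mulOp_le (hob j) (hO j)) _
  have hcont : Continuous fun t => U₁ (-t) (Complex.I • potential D O (V t f)) :=
    continuous_apply_of_bound (G := fun t => U₁ (-t)) (M := 1)
      (fun t x => by rw [hU₁n, one_mul]) (fun x => (hU₁.cont x).comp continuous_neg)
      (((potential D O).continuous.comp (hV.cont f)).const_smul Complex.I)
  -- The isometry $U_1(t)$ carries the error in the interaction picture to the error in the theorem.
  have hdiff : ∀ t g, ‖V t f - phaseRot (α ^ 2 / 4 * t) (U t g)‖ = ‖U₁ (-t) (V t f) - g‖ := by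
    intro t g
    rw [← hU₁n t (U₁ (-t) (V t f) - g), map_sub]
    congr 2
    · exact (hU₁.apply_neg_apply t _).symm
    · rw [← phaseCLM_apply, ← hcomm]
      rfl
  constructor
  · rintro ⟨C, hC⟩
    -- The curve of the interaction picture run backwards; the double negation keeps it literally
    -- the composite with $t\mapsto-t$.
    obtain ⟨g, hg⟩ := exists_limit_of_deriv_decay (Y := fun t => U₁ (- -t) (V (-t) f))
      (Y' := fun t => -U₁ (- -t) (Complex.I • potential D O (V (-t) f))) (C := K' * C)
      (fun t => ((hW f (-t)).scomp t (hasDerivAt_neg t)).congr_deriv (neg_one_smul ℝ _))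
      (hcont.comp continuous_neg).neg
      (fun t ht => by
        rw [norm_neg, mul_assoc]
        exact (hpot (-t)).trans (mul_le_mul_of_nonneg_left (hC t ht) hK'))
    refine ⟨g, (tendsto_iff_norm_sub_tendsto_zero.1 hg).congr fun t => ?_⟩
    rw [← hdiff, mul_neg]
  · rintro ⟨C, hC⟩
    obtain ⟨g, hg⟩ := exists_limit_of_deriv_decay (C := K' * C) (hW f) hcont
      (fun t ht => by
        rw [mul_assoc]
        exact (hpot t).trans (mul_le_mul_of_nonneg_left (hC t ht) hK'))
    refine ⟨g, (tendsto_iff_norm_sub_tendsto_zero.1 hg).congr fun t => ?_⟩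
    rw [← hdiff]
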